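/- Let $\mathbb F$ be a field and let $V$ be an $\mathbb F$-vector space with a basis $\beta=\{v_i \mid i\in\mathbb N\}$ indexed, and ordered, by the natural numbers. Let $\mathrm{UT}_\beta V$ be the algebra of all $t\in\mathrm{End}_{\mathbb F}V$ with $t(v_j)\in\mathrm{Span}\{v_i\mid i\le j\}$ for all $j$. Let $e_{ij}\in\mathrm{End}_{\mathbb F}V$ be the matrix unit with $e_{ij}(v_k)=\delta_{jk}v_i$, and let $\mathrm{UT}_{\to\beta}V=\mathrm{Span}\{e_{ij}\mid i\le j\}$, which is the direct limit of the algebras $\mathrm{UT}_n(\mathbb F)$. A group grading on an algebra $A$ is a decomposition $\Gamma\colon A=\bigoplus_{g\in G}A_g$ into subspaces, where $G$ is an arbitrary group (not necessarily abelian), with $A_gA_h\subseteq A_{gh}$ for all $g,h\in G$. It is finite if only finitely many $A_g$ are nonzero. A grading $\Gamma'\colon A=\bigoplus_{h\in H}A'_h$ by a possibly different group $H$ is a refinement of $\Gamma$ if every $A'_h$ is contained in some $A_g$; it is a proper refinement if, moreover, the two decompositions into nonzero components differ. A group grading is fine if no group grading is a proper refinement of it. Two group gradings on $A$ are equivalent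 if some algebra automorphism of $A$ maps the set of nonzero components of the first onto the set of nonzero components of the second. **Theorem.** 1. Every group grading on $\mathrm{UT}_\beta V$ has a proper refinement that is a finite group grading. In particular, there is no fine group grading on $\mathrm{UT}_\beta V$. 2. There is a unique fine group grading on $\mathrm{UT}_{\to\beta}V$ up to equivalence, namely the $\mathbb Z^{\mathbb N}$-grading $\Gamma_U$ defined by $\gamma\colon\mathbb N\to\mathbb Z^{\mathbb N}$, $\gamma(i)(j)=\delta_{ij}$, in which $e_{ij}$ $(i\le j)$ is homogeneous of degree $\gamma(j)-\gamma(i)$. That is, $\Gamma_U$ is fine, and every fine group grading on $\mathrm{UT}_{\to\beta}V$ is equivalent to $\Gamma_U$. -/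

import Mathlib

section Gradings

variable (F : Type*) [Field F]

/-- A grading of a (not necessarily unital) associative `F`-algebra `A` by an arbitrary
(not necessarily abelian) group `G`: a decomposition of `A` as the internal direct sum of subspaces
`A_g`, `g ∈ G`, some of which may be zero, with `A_g A_h ⊆ A_{gh}`. -/
structure GroupGrading (G : Type*) [Group G] (A : Type*) [NonUnitalRing A] [Module F A] where
  /-- the homogeneous component of degree `g` -/
  component : G → Submodule F A
  iSupIndep_component : iSupIndep component
  iSup_component : ⨆ g, component g = ⊤
  mul_mem : ∀ {g h : G} {x y : A}, x ∈ component g → y ∈ component h → x * y ∈ component (g * h)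

namespace GroupGrading

variable {F}
variable {A : Type*} [NonUnitalRing A] [Module F A]
variable {G : Type*} [Group G] {H : Type*} [Group H]

/-- The support `{g ∈ G | A_g ≠ 0}`. -/
def support (Γ : GroupGrading F G A) : Set G :=
  {g | Γ.component g ≠ ⊥}

/-- A grading is finite if its support is finite. -/
def IsFinite (Γ : GroupGrading F G A) : Prop :=
  Γ.support.Finite

/-- The set of nonzero homogeneous components, i.e. the decomposition of `A` without its labels. -/
def components (Γ : GroupGrading F G A) : Set (Submodule F A) :=
  Γ.component '' Γ.support

/-- `Γ'.IsRefinementOf Γ`: each component of `Γ'` is contained in a component of `Γ`.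
The two grading groups may be different. -/
def IsRefinementOf (Γ' : GroupGrading F H A) (Γ : GroupGrading F G A) : Prop :=
  ∀ h : H, ∃ g : G, Γ'.component h ≤ Γ.component g

/-- A refinement is proper if the two decompositions of `A` into nonzero components differ. -/
def IsProperRefinementOf (Γ' : GroupGrading F H A) (Γ : GroupGrading F G A) : Prop :=
  Γ'.IsRefinementOf Γ ∧ Γ'.components ≠ Γ.components

/-- A grading is fine if no grading, by whatever group, is a proper refinement of it.
The universe `w` of the competing groups is an independent parameter. -/
def IsFine.{w, u₁, u₂, u₃} {F : Type u₁} [Field F] {A : Type u₂} [NonUnitalRing A] [Module F A]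
    {G : Type u₃} [Group G] (Γ : GroupGrading F G A) : Prop :=
  ∀ (H : Type w) [Group H] (Γ' : GroupGrading F H A), ¬ Γ'.IsProperRefinementOf Γ

/-- Two gradings on `A`, by possibly different groups, are equivalent if some algebra automorphism
of `A` carries the nonzero homogeneous components of the first one onto those of the second. -/
def Equivalent (Γ : GroupGrading F G A) (Γ' : GroupGrading F H A) : Prop :=
  ∃ φ : A ≃ₗ[F] A, (∀ x y, φ (x * y) = φ x * φ y) ∧
    (fun S : Submodule F A => S.map (φ : A →ₗ[F] A)) '' Γ.components = Γ'.components

end GroupGrading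

end Gradings

section Triangular

variable {F : Type*} [Field F] {V : Type*} [AddCommGroup V] [Module F V]
variable {ι : Type*}

/-- The matrix unit `e_{ij}`: it sends `b j` to `b i` and every other basis vector to `0`. -/
noncomputable def matrixUnit (b : Module.Basis ι F V) (i j : ι) : Module.End F V :=
  (b.coord j).smulRight (b i)

theorem matrixUnit_apply_self (b : Module.Basis ι F V) (i j : ι) :
    matrixUnit b i j (b j) = b i := by
  simp [matrixUnit]

theorem matrixUnit_apply_of_ne (b : Module.Basis ι F V) (i : ι) {j k : ι} (h : k ≠ j) :
    matrixUnit b i j (b k) = 0 := by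
  simp [matrixUnit, h]

theorem matrixUnit_mul_same (b : Module.Basis ι F V) (i j k : ι) :
    matrixUnit b i j * matrixUnit b j k = matrixUnit b i k := by
  ext v
  simp [matrixUnit]

theorem matrixUnit_mul_of_ne (b : Module.Basis ι F V) (i l : ι) {j k : ι} (h : j ≠ k) :
    matrixUnit b i j * matrixUnit b k l = 0 := by
  ext v
  simp [matrixUnit, h.symm]

theorem linearIndependent_matrixUnit (b : Module.Basis ι F V) :
    LinearIndependent F (fun p : ι × ι => matrixUnit b p.1 p.2) := by
  rw [linearIndependent_iff]
  intro l hl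
  ext ⟨i, j⟩
  have h := congrArg (fun t : Module.End F V => b.repr (t (b j)) i) hl
  simp only [Finsupp.linearCombination_apply, Finsupp.sum, LinearMap.sum_apply, map_sum,
    LinearMap.smul_apply, map_smul, Finsupp.coe_finsetSum, Finset.sum_apply, Finsupp.smul_apply,
    LinearMap.zero_apply, map_zero, Finsupp.coe_zero, Pi.zero_apply] at h
  rw [Finset.sum_eq_single (i, j)] at h
  · simpa [matrixUnit] using h
  · rintro ⟨i', j'⟩ - hne
    by_cases hj : j = j'
    · subst hj
      have hi : i' ≠ i := fun h => hne (by rw [h])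
      simp [matrixUnit_apply_self, hi]
    · simp [matrixUnit_apply_of_ne b i' hj]
  · intro hn
    simp [Finsupp.notMem_support_iff.1 hn]

variable [Preorder ι]

/-- The algebra of all endomorphisms `t` of `V` that are upper triangular with respect to the
ordered basis `b`: `t (b j)` lies in the span of the `b i` with `i ≤ j`. -/
def upperTriangular (b : Module.Basis ι F V) : Subalgebra F (Module.End F V) where
  carrier := {t | ∀ j, t (b j) ∈ Submodule.span F (b '' Set.Iic j)}
  mul_mem' := by
    intro s t hs ht j
    have key : Submodule.span F (b '' Set.Iic j) ≤
        (Submodule.span F (b '' Set.Iic j)).comap s := by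
      rw [Submodule.span_le]
      rintro _ ⟨i, hi, rfl⟩
      exact Submodule.span_mono (Set.image_mono (Set.Iic_subset_Iic.2 hi)) (hs i)
    exact key (ht j)
  add_mem' := fun hs ht j => Submodule.add_mem _ (hs j) (ht j)
  algebraMap_mem' := fun c j => by
    rw [Module.algebraMap_end_apply]
    exact Submodule.smul_mem _ _ (Submodule.subset_span ⟨j, Set.mem_Iic.2 le_rfl, rfl⟩)

/-- The span of the matrix units `e_{ij}` with `i ≤ j`, a subalgebra of `End V` without unit if
`ι` is infinite. For `ι = ℕ` it is the direct limit of the algebras `UT_n(F)`. -/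
def upperTriangularLim (b : Module.Basis ι F V) : NonUnitalSubalgebra F (Module.End F V) where
  __ := Submodule.span F {t | ∃ i j, i ≤ j ∧ t = matrixUnit b i j}
  mul_mem' := by
    intro s t hs ht
    refine Submodule.span_induction₂ (p := fun s t _ _ =>
      s * t ∈ Submodule.span F {t | ∃ i j, i ≤ j ∧ t = matrixUnit b i j})
      ?_ ?_ ?_ ?_ ?_ ?_ ?_ hs ht
    · rintro _ _ ⟨i, j, hij, rfl⟩ ⟨k, l, hkl, rfl⟩
      by_cases h : j = k
      · subst h
        rw [matrixUnit_mul_same]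
        exact Submodule.subset_span ⟨i, l, hij.trans hkl, rfl⟩
      · rw [matrixUnit_mul_of_ne b i l h]
        exact Submodule.zero_mem _
    · intro y _; rw [zero_mul]; exact Submodule.zero_mem _
    · intro x _; rw [mul_zero]; exact Submodule.zero_mem _
    · intro x y z _ _ _ h1 h2; rw [add_mul]; exact Submodule.add_mem _ h1 h2
    · intro x y z _ _ _ h1 h2; rw [mul_add]; exact Submodule.add_mem _ h1 h2
    · intro c x y _ _ h; rw [smul_mul_assoc]; exact Submodule.smul_mem _ _ h
    · intro c x y _ _ h; rw [mul_smul_comm]; exact Submodule.smul_mem _ _ h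

/-- The matrix unit `e_{ij}`, `i ≤ j`, as an element of `upperTriangularLim b`; the pair `(i, j)`
is `p`. -/
noncomputable def limUnit (b : Module.Basis ι F V) (p : {p : ι × ι // p.1 ≤ p.2}) :
    upperTriangularLim b :=
  ⟨matrixUnit b p.1.1 p.1.2, Submodule.subset_span ⟨p.1.1, p.1.2, p.2, rfl⟩⟩

theorem linearIndependent_limUnit (b : Module.Basis ι F V) :
    LinearIndependent F (limUnit b) := by
  have h := (linearIndependent_matrixUnit b).comp
    (Subtype.val : {p : ι × ι // p.1 ≤ p.2} → ι × ι) Subtype.val_injective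
  exact LinearIndependent.of_comp (upperTriangularLim b).toSubmodule.subtype h

theorem span_limUnit (b : Module.Basis ι F V) :
    Submodule.span F (Set.range (limUnit b)) = ⊤ := by
  rw [eq_top_iff]
  rintro ⟨t, ht⟩ -
  refine Submodule.span_induction (p := fun t ht =>
    (⟨t, ht⟩ : upperTriangularLim b) ∈ Submodule.span F (Set.range (limUnit b))) ?_ ?_ ?_ ?_ ht
  · rintro _ ⟨i, j, hij, rfl⟩
    exact Submodule.subset_span ⟨⟨(i, j), hij⟩, rfl⟩
  · exact Submodule.zero_mem _
  · intro x y _ _ hx hy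
    exact Submodule.add_mem _ hx hy
  · intro c x _ hx
    exact Submodule.smul_mem _ c hx

/-- The elementary `G`-grading on `upperTriangularLim b` defined by a map `γ : ι → G`: the matrix
unit `e_{ij}`, `i ≤ j`, has degree `γ(i)⁻¹ γ(j)`, so the component of degree `g` is the span of
the matrix units with `γ(i)⁻¹ γ(j) = g`. -/
noncomputable def elementaryGrading (b : Module.Basis ι F V) {G : Type*} [Group G] (γ : ι → G) :
    GroupGrading F G (upperTriangularLim b) where
  component g := Submodule.span F (limUnit b '' {p | (γ p.1.1)⁻¹ * γ p.1.2 = g})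
  iSupIndep_component := by
    intro g
    have hle : (⨆ (h : G) (_ : h ≠ g),
        Submodule.span F (limUnit b '' {p | (γ p.1.1)⁻¹ * γ p.1.2 = h})) ≤
        Submodule.span F (limUnit b '' {p | (γ p.1.1)⁻¹ * γ p.1.2 ≠ g}) := by
      refine iSup₂_le fun h hne => Submodule.span_mono (Set.image_mono ?_)
      intro p hp hpg
      exact hne (hp.symm.trans hpg)
    refine Disjoint.mono_right hle ((linearIndependent_limUnit b).disjoint_span_image ?_)
    rw [Set.disjoint_left]
    exact fun p hp hn => hn hp
  iSup_component := by
    rw [eq_top_iff, ← span_limUnit b, Submodule.span_le]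
    rintro _ ⟨p, rfl⟩
    exact Submodule.mem_iSup_of_mem ((γ p.1.1)⁻¹ * γ p.1.2)
      (Submodule.subset_span ⟨p, rfl, rfl⟩)
  mul_mem := by
    intro g h x y hx hy
    refine Submodule.span_induction₂ (p := fun x y _ _ =>
      x * y ∈ Submodule.span F (limUnit b '' {p | (γ p.1.1)⁻¹ * γ p.1.2 = g * h}))
      ?_ ?_ ?_ ?_ ?_ ?_ ?_ hx hy
    · rintro _ _ ⟨⟨⟨i, j⟩, hij⟩, hg, rfl⟩ ⟨⟨⟨k, l⟩, hkl⟩, hh, rfl⟩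
      by_cases e : j = k
      · subst e
        refine Submodule.subset_span ⟨⟨(i, l), le_trans hij hkl⟩, ?_, ?_⟩
        · simp only [Set.mem_ofPred_eq] at hg hh ⊢
          rw [← hg, ← hh]
          group
        · exact Subtype.ext (matrixUnit_mul_same b i j l).symm
      · have h0 : limUnit b ⟨(i, j), hij⟩ * limUnit b ⟨(k, l), hkl⟩ = 0 :=
          Subtype.ext (matrixUnit_mul_of_ne b i l e)
        rw [h0]
        exact Submodule.zero_mem _
    · intro y _; rw [zero_mul]; exact Submodule.zero_mem _
    · intro x _; rw [mul_zero]; exact Submodule.zero_mem _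
    · intro x y z _ _ _ h1 h2; rw [add_mul]; exact Submodule.add_mem _ h1 h2
    · intro x y z _ _ _ h1 h2; rw [mul_add]; exact Submodule.add_mem _ h1 h2
    · intro c x y _ _ h; rw [smul_mul_assoc]; exact Submodule.smul_mem _ _ h
    · intro c x y _ _ h; rw [mul_smul_comm]; exact Submodule.smul_mem _ _ h

/-- The map `γ : ℕ → ℤ^ℕ` with `γ(i)(j) = δ_{ij}`; the additive group `ℤ^ℕ` is written
multiplicatively. -/
def deltaMap (i : ℕ) : Multiplicative (ℕ → ℤ) :=
  Multiplicative.ofAdd (Pi.single i 1)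

end Triangular

-- Universes of the field, the vector space and the grading groups in the theorem.
universe u v w w'

/-! Everything rests on one fact: for any group grading on either algebra, some basis c spanning the
same flag as b has all its diagonal matrix units in the algebra and homogeneous of degree 1. Then
e_ii A e_jj is the line through e_ij (i ≤ j), so every matrix unit is homogeneous as well
(`exists_degree`).

The diagonal units are split off one at a time. Let ε be an idempotent of degree 1, n its first
nonzero diagonal position, C = εAε, χ the n-th diagonal entry and q = ε e_nn ε. Triangularity makes
χ multiplicative and gives a q = χ(a) q for a in C. Taking components, a q_g = χ(a) q_{hg} for a in
C of degree h, so χ(q_h) = χ(q_1) for each degree h of C on which χ does not vanish. As the χ(q_h)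
add up to χ(q) = 1, χ(q_1) ≠ 0, and q_1/χ(q_1) is an idempotent of degree 1. The same comparison for
r = ε e_nj ε with j > n gives r q_1 = 0, so q_1 has no entries below row n, hence rank one
(`exists_homogeneous_idempotent`, `exists_rank_one`). Subtracting and repeating yields orthogonal
f_i, and the vectors f_i b_i form c (`IdempotentFamily.exists_basis`).

In the full algebra ε starts as 1. If e_{0i} has degree d_i, then e_ij has degree d_i⁻¹ d_j. The
operator sending every c_j to c_0 has a nonzero component in each degree d_j, so only finitely many
d_j occur. Two indices therefore share a degree; giving one of them a label of its own, and using
free labels in ℤ^ℕ, produces a finite proper refinement.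

The limit algebra has no unit. The degree 1 part of a large truncation is a local unit, and a
polynomial in it without constant term is an idempotent local unit; the f_i are chosen to exhaust
such idempotents, so that the matrix units of c span the same algebra. Any grading is then refined
by a copy of Γ_U, and fineness forces equality. Γ_U itself is fine because its off-diagonal
components are lines, and a diagonal element, homogeneous in a refinement, with nonzero (i,i) entry
multiplies e_{i,i+1} by a nonzero scalar, hence has degree 1. -/

namespace GroupGrading

/-! ### Homogeneous components of elements, and homogeneous idempotents -/

section Projection

variable {F : Type*} [Field F] {A : Type*} [NonUnitalRing A] [Module F A]
variable {G : Type*} [Group G]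

open scoped Classical in
/-- The projection onto the homogeneous component of degree `g`. -/
noncomputable def proj (Γ : GroupGrading F G A) (g : G) : A →ₗ[F] A :=
  (Γ.component g).subtype ∘ₗ DirectSum.component F G (fun g => Γ.component g) g ∘ₗ
    (LinearEquiv.ofBijective (DirectSum.coeLinearMap Γ.component)
      (DirectSum.isInternal_submodule_of_iSupIndep_of_iSup_eq_top
        Γ.iSupIndep_component Γ.iSup_component)).symm.toLinearMap

theorem proj_mem (Γ : GroupGrading F G A) (g : G) (x : A) : Γ.proj g x ∈ Γ.component g := by
  simp [proj]

open scoped Classical in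
theorem proj_of_mem_eq_ite (Γ : GroupGrading F G A) {g : G} {x : A} (hx : x ∈ Γ.component g)
    (h : G) : Γ.proj h x = if g = h then x else 0 := by
  have key : (LinearEquiv.ofBijective (DirectSum.coeLinearMap Γ.component)
      (DirectSum.isInternal_submodule_of_iSupIndep_of_iSup_eq_top
        Γ.iSupIndep_component Γ.iSup_component)).symm x =
      DirectSum.lof F G (fun g => Γ.component g) g ⟨x, hx⟩ := by
    rw [LinearEquiv.symm_apply_eq]
    exact (DirectSum.coeLinearMap_lof Γ.component g ⟨x, hx⟩).symm
  simp only [proj, LinearMap.comp_apply, LinearEquiv.coe_coe, key]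
  split_ifs with hgh
  · subst hgh
    simp [DirectSum.component.lof_self]
  · simp [DirectSum.component.of, hgh]

theorem proj_of_mem (Γ : GroupGrading F G A) {g : G} {x : A} (hx : x ∈ Γ.component g) :
    Γ.proj g x = x := by
  rw [proj_of_mem_eq_ite Γ hx, if_pos rfl]

theorem proj_of_mem_of_ne (Γ : GroupGrading F G A) {g h : G} (hgh : g ≠ h) {x : A}
    (hx : x ∈ Γ.component g) : Γ.proj h x = 0 := by
  rw [proj_of_mem_eq_ite Γ hx, if_neg hgh]

/-- Every element is the sum of its finitely many nonzero homogeneous components. -/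
theorem exists_sum_proj (Γ : GroupGrading F G A) (x : A) :
    ∃ s : Finset G, (∀ g ∉ s, Γ.proj g x = 0) ∧ ∑ g ∈ s, Γ.proj g x = x := by
  classical
  have hx : x ∈ ⨆ g, Γ.component g := by rw [Γ.iSup_component]; trivial
  induction hx using Submodule.iSup_induction' with
  | mem g x hx =>
    refine ⟨{g}, fun h hh => Γ.proj_of_mem_of_ne (by simpa [eq_comm] using hh) hx, ?_⟩
    rw [Finset.sum_singleton, Γ.proj_of_mem hx]
  | zero => exact ⟨∅, by simp, by simp⟩
  | add x y _ _ hx hy =>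
    obtain ⟨s, hs, hsx⟩ := hx
    obtain ⟨t, ht, hty⟩ := hy
    refine ⟨s ∪ t, fun g hg => ?_, ?_⟩
    · rw [Finset.notMem_union] at hg
      rw [map_add, hs g hg.1, ht g hg.2, add_zero]
    · simp only [map_add, Finset.sum_add_distrib]
      rw [← Finset.sum_subset Finset.subset_union_left fun g _ hg => hs g hg,
        ← Finset.sum_subset Finset.subset_union_right fun g _ hg => ht g hg, hsx, hty]

theorem ext_proj (Γ : GroupGrading F G A) {x y : A} (h : ∀ g, Γ.proj g x = Γ.proj g y) :
    x = y := by
  obtain ⟨s, -, hs⟩ := Γ.exists_sum_proj (x - y)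
  rw [← sub_eq_zero, ← hs]
  exact Finset.sum_eq_zero fun g _ => by rw [map_sub, h g, sub_self]

theorem mem_component_of_proj_eq_zero (Γ : GroupGrading F G A) {g : G} {x : A}
    (h : ∀ k, k ≠ g → Γ.proj k x = 0) : x ∈ Γ.component g := by
  have : x = Γ.proj g x := by
    refine Γ.ext_proj fun k => ?_
    rcases eq_or_ne k g with rfl | hk
    · rw [Γ.proj_of_mem (Γ.proj_mem k x)]
    · rw [h k hk, Γ.proj_of_mem_of_ne hk.symm (Γ.proj_mem g x)]
  rw [this]
  exact Γ.proj_mem g x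

theorem exists_proj_ne_zero (Γ : GroupGrading F G A) {x : A} (hx : x ≠ 0) :
    ∃ g, Γ.proj g x ≠ 0 := by
  by_contra! h
  exact hx (Γ.ext_proj fun g => by rw [h g, map_zero])

theorem degree_unique (Γ : GroupGrading F G A) {x : A} (hx : x ≠ 0) {g h : G}
    (hg : x ∈ Γ.component g) (hh : x ∈ Γ.component h) : g = h := by
  by_contra hne
  exact hx ((Γ.proj_of_mem hh).symm.trans (Γ.proj_of_mem_of_ne hne hg))

theorem proj_mul_left (Γ : GroupGrading F G A) {h : G} {a : A} (ha : a ∈ Γ.component h)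
    (g : G) (x : A) : Γ.proj (h * g) (a * x) = a * Γ.proj g x := by
  classical
  obtain ⟨s, hs, hx⟩ := Γ.exists_sum_proj x
  conv_lhs => rw [← hx, Finset.mul_sum, map_sum]
  have key : ∀ k, Γ.proj (h * g) (a * Γ.proj k x) = if k = g then a * Γ.proj k x else 0 := by
    intro k
    rw [Γ.proj_of_mem_eq_ite (Γ.mul_mem ha (Γ.proj_mem k x))]
    simp
  simp only [key, Finset.sum_ite_eq']
  split_ifs with hg
  · rfl
  · rw [hs g hg, mul_zero]

theorem proj_mul_right (Γ : GroupGrading F G A) {h : G} {a : A} (ha : a ∈ Γ.component h)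
    (g : G) (x : A) : Γ.proj (g * h) (x * a) = Γ.proj g x * a := by
  classical
  obtain ⟨s, hs, hx⟩ := Γ.exists_sum_proj x
  conv_lhs => rw [← hx, Finset.sum_mul, map_sum]
  have key : ∀ k, Γ.proj (g * h) (Γ.proj k x * a) = if k = g then Γ.proj k x * a else 0 := by
    intro k
    rw [Γ.proj_of_mem_eq_ite (Γ.mul_mem (Γ.proj_mem k x) ha)]
    simp
  simp only [key, Finset.sum_ite_eq']
  split_ifs with hg
  · rfl
  · rw [hs g hg, zero_mul]

theorem proj_one_mul (Γ : GroupGrading F G A) {a : A} (ha : a ∈ Γ.component 1)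
    (g : G) (x : A) : Γ.proj g (a * x) = a * Γ.proj g x := by
  simpa using Γ.proj_mul_left ha g x

theorem proj_mul_one (Γ : GroupGrading F G A) {a : A} (ha : a ∈ Γ.component 1)
    (g : G) (x : A) : Γ.proj g (x * a) = Γ.proj g x * a := by
  simpa using Γ.proj_mul_right ha g x

/-- Let `C = ε A ε` be the corner of a homogeneous idempotent `ε` of degree `1`, let `χ` be a
multiplicative functional, and suppose that `C` contains an element `q` with `χ q = 1` on which
`C` acts from the left through `χ`. If every element of `C` that is annihilated from the left by
`{r ∈ ker χ | C acts on r through χ}` has this property, too, then `C` contains a homogeneous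
idempotent of degree `1` with the properties of `q`. -/
theorem exists_homogeneous_idempotent [IsScalarTower F A A] [SMulCommClass F A A]
    (Γ : GroupGrading F G A) {ε : A} (hε : ε ∈ Γ.component 1) (χ : A →ₗ[F] F)
    (hχ : ∀ x y, χ (x * y) = χ x * χ y) {q : A} (hq₁ : ε * q = q) (hq₂ : q * ε = q)
    (hχq : χ q = 1) (hq : ∀ a, ε * a = a → a * ε = a → a * q = χ a • q)
    (hC : ∀ x, ε * x = x → x * ε = x →
      (∀ r, ε * r = r → r * ε = r → χ r = 0 →
        (∀ a, ε * a = a → a * ε = a → a * r = χ a • r) → r * x = 0) →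
      ∀ a, ε * a = a → a * ε = a → a * x = χ a • x) :
    ∃ f ∈ Γ.component 1, ε * f = f ∧ f * ε = f ∧ f * f = f ∧ χ f = 1 ∧
      ∀ a, ε * a = a → a * ε = a → a * f = χ a • f := by
  have hl : ∀ {x : A} (g : G), ε * x = x → ε * Γ.proj g x = Γ.proj g x := fun {x} g hx => by
    rw [← Γ.proj_one_mul hε, hx]
  have hr : ∀ {x : A} (g : G), x * ε = x → Γ.proj g x * ε = Γ.proj g x := fun {x} g hx => by
    rw [← Γ.proj_mul_one hε, hx]
  -- Compare the components of degree hg in a r = χ(a) r.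
  have shift : ∀ r, (∀ a, ε * a = a → a * ε = a → a * r = χ a • r) →
      ∀ (h g : G) (a : A), a ∈ Γ.component h → ε * a = a → a * ε = a →
        a * Γ.proj g r = χ a • Γ.proj (h * g) r := fun r hrr h g a ha ha₁ ha₂ => by
    rw [← Γ.proj_mul_left ha, hrr a ha₁ ha₂, map_smul]
  have hsum : ∀ x, ∃ s : Finset G, (∀ g ∉ s, χ (Γ.proj g x) = 0) ∧
      ∑ g ∈ s, χ (Γ.proj g x) = χ x := fun x => by
    obtain ⟨s, hs, hx⟩ := Γ.exists_sum_proj x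
    refine ⟨s, fun g hg => by rw [hs g hg, map_zero], ?_⟩
    rw [← map_sum, hx]
  -- `χ (r_g)` is constant on the set of degrees on which `χ` does not vanish
  have const : ∀ r, (∀ a, ε * a = a → a * ε = a → a * r = χ a • r) →
      ∀ (a : A) (h : G), a ∈ Γ.component h →
        ε * a = a → a * ε = a → χ a ≠ 0 → χ (Γ.proj h r) = χ (Γ.proj 1 r) := by
    intro r hrr a h ha ha₁ ha₂ hne
    have h1 := congrArg χ (shift r hrr h 1 a ha ha₁ ha₂)
    rw [hχ, map_smul, smul_eq_mul, mul_one] at h1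
    exact (mul_left_cancel₀ hne h1).symm
  -- If χ vanishes on the corner in degree g, both sides are zero; otherwise both equal χ(q_1)
  -- χ(r_1).
  have cross : ∀ r, ε * r = r → r * ε = r →
      (∀ a, ε * a = a → a * ε = a → a * r = χ a • r) → ∀ g,
        χ (Γ.proj g q) * χ (Γ.proj 1 r) = χ (Γ.proj 1 q) * χ (Γ.proj g r) := by
    intro r hr₁ hr₂ hrr g
    by_cases hg : ∃ a ∈ Γ.component g, ε * a = a ∧ a * ε = a ∧ χ a ≠ 0
    · obtain ⟨a, ha, ha₁, ha₂, hne⟩ := hg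
      rw [const r hrr a g ha ha₁ ha₂ hne, const q hq a g ha ha₁ ha₂ hne]
    · push Not at hg
      rw [hg _ (Γ.proj_mem g q) (hl g hq₁) (hr g hq₂),
        hg _ (Γ.proj_mem g r) (hl g hr₁) (hr g hr₂), zero_mul, mul_zero]
  have hc : χ (Γ.proj 1 q) ≠ 0 := by
    intro h0
    obtain ⟨s, -, hs⟩ := hsum q
    have : ∀ g, χ (Γ.proj g q) = 0 := by
      intro g
      by_contra hne
      exact hne ((const q hq _ g (Γ.proj_mem g q) (hl g hq₁) (hr g hq₂) hne).trans h0)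
    rw [Finset.sum_eq_zero fun g _ => this g, hχq] at hs
    exact zero_ne_one hs
  have hann : ∀ r, ε * r = r → r * ε = r → χ r = 0 →
      (∀ a, ε * a = a → a * ε = a → a * r = χ a • r) → r * Γ.proj 1 q = 0 := by
    intro r hr₁ hr₂ hr0 hrr
    -- Summing `cross` over all degrees gives χ(q) χ(r_1) = χ(q_1) χ(r) = 0. No division by the
    -- number of degrees occurs, so the characteristic plays no role.
    have h1 : χ (Γ.proj 1 r) = 0 := by
      classical
      obtain ⟨s, hs, hsq⟩ := hsum q
      obtain ⟨t, ht, htr⟩ := hsum r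
      calc χ (Γ.proj 1 r) = ∑ g ∈ s ∪ t, χ (Γ.proj g q) * χ (Γ.proj 1 r) := by
            rw [← Finset.sum_mul, ← Finset.sum_subset Finset.subset_union_left
              fun g _ hg => hs g hg, hsq, hχq, one_mul]
        _ = ∑ g ∈ s ∪ t, χ (Γ.proj 1 q) * χ (Γ.proj g r) :=
            Finset.sum_congr rfl fun g _ => cross r hr₁ hr₂ hrr g
        _ = 0 := by
            rw [← Finset.mul_sum, ← Finset.sum_subset Finset.subset_union_right
              fun g _ hg => ht g hg, htr, hr0, mul_zero]
    have h2 : ∀ g, χ (Γ.proj g r) = 0 := fun g => by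
      have := cross r hr₁ hr₂ hrr g
      rw [h1, mul_zero] at this
      exact (mul_eq_zero.1 this.symm).resolve_left hc
    obtain ⟨t, -, htr⟩ := Γ.exists_sum_proj r
    rw [← htr, Finset.sum_mul]
    refine Finset.sum_eq_zero fun g _ => ?_
    -- Here r_g q_1 = χ(r_g) q_g, and χ(r_g) = 0.
    rw [shift q hq g 1 _ (Γ.proj_mem g r) (hl g hr₁) (hr g hr₂), h2, zero_smul]
  have hact := hC (Γ.proj 1 q) (hl 1 hq₁) (hr 1 hq₂) hann
  have hχf : χ ((χ (Γ.proj 1 q))⁻¹ • Γ.proj 1 q) = 1 := by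
    rw [map_smul, smul_eq_mul, inv_mul_cancel₀ hc]
  have hf₁ : ε * ((χ (Γ.proj 1 q))⁻¹ • Γ.proj 1 q) = (χ (Γ.proj 1 q))⁻¹ • Γ.proj 1 q := by
    rw [mul_smul_comm, hl 1 hq₁]
  have hf₂ : ((χ (Γ.proj 1 q))⁻¹ • Γ.proj 1 q) * ε = (χ (Γ.proj 1 q))⁻¹ • Γ.proj 1 q := by
    rw [smul_mul_assoc, hr 1 hq₂]
  have hf : ∀ a, ε * a = a → a * ε = a → a * ((χ (Γ.proj 1 q))⁻¹ • Γ.proj 1 q) =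
      χ a • ((χ (Γ.proj 1 q))⁻¹ • Γ.proj 1 q) := fun a ha₁ ha₂ => by
    rw [mul_smul_comm, hact a ha₁ ha₂, smul_comm]
  refine ⟨_, Submodule.smul_mem _ _ (Γ.proj_mem 1 q), hf₁, hf₂, ?_, hχf, hf⟩
  rw [hf _ hf₁ hf₂, hχf, one_smul]

end Projection

/-! ### Refinements and transport of gradings -/

section Refinement

variable {F : Type*} [Field F] {A : Type*} [NonUnitalRing A] [Module F A]
variable {G : Type*} [Group G] {H : Type*} [Group H]

theorem mem_support_of_mem {Γ : GroupGrading F G A} {g : G} {x : A} (hx : x ≠ 0)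
    (hg : x ∈ Γ.component g) : g ∈ Γ.support :=
  fun h0 => hx ((Submodule.mem_bot F).1 (h0 ▸ hg))

/-- In a chain A_g ≤ A'_h ≤ A_{g'} with A_g ≠ 0, a nonzero element of A_g has only one degree, so g
= g' and both inclusions are equalities. -/
theorem components_subset_of_isRefinementOf {Γ : GroupGrading F G A} {Γ' : GroupGrading F H A}
    (h₁ : Γ.IsRefinementOf Γ') (h₂ : Γ'.IsRefinementOf Γ) : Γ.components ⊆ Γ'.components := by
  rintro _ ⟨g, hg, rfl⟩
  obtain ⟨x, hx, hx0⟩ := Submodule.exists_mem_ne_zero_of_ne_bot hg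
  obtain ⟨h, hh⟩ := h₁ g
  obtain ⟨g', hg'⟩ := h₂ h
  have := Γ.degree_unique hx0 hx (hg' (hh hx))
  subst this
  exact ⟨h, mem_support_of_mem hx0 (hh hx), le_antisymm hg' hh⟩

theorem components_eq_of_isRefinementOf {Γ : GroupGrading F G A} {Γ' : GroupGrading F H A}
    (h₁ : Γ.IsRefinementOf Γ') (h₂ : Γ'.IsRefinementOf Γ) : Γ.components = Γ'.components :=
  (components_subset_of_isRefinementOf h₁ h₂).antisymm (components_subset_of_isRefinementOf h₂ h₁)

/-- The components of `Γ` are graded subspaces with respect to any refinement of `Γ`. -/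
theorem IsRefinementOf.proj_mem {Γ : GroupGrading F G A} {Γ' : GroupGrading F H A}
    (hr : Γ'.IsRefinementOf Γ) {g : G} {x : A} (hx : x ∈ Γ.component g) (h : H) :
    Γ'.proj h x ∈ Γ.component g := by
  classical
  choose d hd using hr
  obtain ⟨s, hs, hsx⟩ := Γ'.exists_sum_proj x
  -- the components of degrees over `g` add up to `x`
  have key : ∑ k ∈ s with d k = g, Γ'.proj k x = x := by
    conv_rhs => rw [← Γ.proj_of_mem hx, ← hsx, map_sum]
    rw [Finset.sum_filter]
    refine Finset.sum_congr rfl fun k _ => ?_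
    rw [Γ.proj_of_mem_eq_ite (hd k (Γ'.proj_mem k x))]
  rcases eq_or_ne (d h) g with hg | hg
  · exact hg ▸ hd h (Γ'.proj_mem h x)
  · have : Γ'.proj h x = 0 := by
      rw [← key, map_sum]
      refine Finset.sum_eq_zero fun k hk => ?_
      refine Γ'.proj_of_mem_of_ne ?_ (Γ'.proj_mem k x)
      rintro rfl
      exact hg (Finset.mem_filter.1 hk).2
    rw [this]
    exact Submodule.zero_mem _

/-- The grading obtained from `Γ` by transport along an algebra isomorphism and an isomorphism of
the grading groups. -/
def transport {B : Type*} [NonUnitalRing B] [Module F B] (Γ : GroupGrading F G A)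
    (φ : A ≃ₗ[F] B) (hφ : ∀ x y, φ (x * y) = φ x * φ y) (e : H ≃* G) : GroupGrading F H B where
  component h := (Γ.component (e h)).map (φ : A →ₗ[F] B)
  iSupIndep_component := by
    have h1 : iSupIndep fun h => Γ.component (e h) :=
      Γ.iSupIndep_component.comp e.injective
    exact h1.map_orderIso (Submodule.orderIsoMapComap φ)
  iSup_component := by
    rw [← Submodule.map_iSup, e.surjective.iSup_comp, Γ.iSup_component, Submodule.map_top,
      LinearMap.range_eq_top]
    exact φ.surjective
  mul_mem := by
    rintro g h _ _ ⟨x, hx, rfl⟩ ⟨y, hy, rfl⟩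
    refine ⟨x * y, ?_, by simp [hφ]⟩
    rw [map_mul]
    exact Γ.mul_mem hx hy

theorem components_transport {B : Type*} [NonUnitalRing B] [Module F B] (Γ : GroupGrading F G A)
    (φ : A ≃ₗ[F] B) (hφ : ∀ x y, φ (x * y) = φ x * φ y) (e : H ≃* G) :
    (Γ.transport φ hφ e).components =
      (fun S : Submodule F A => S.map (φ : A →ₗ[F] B)) '' Γ.components := by
  have hbot : ∀ S : Submodule F A, S.map (φ : A →ₗ[F] B) = ⊥ ↔ S = ⊥ := fun S => by
    rw [Submodule.map_eq_bot_iff]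
  ext S
  constructor
  · rintro ⟨h, hh, rfl⟩
    exact ⟨_, ⟨e h, fun h0 => hh ((hbot _).2 h0), rfl⟩, rfl⟩
  · rintro ⟨_, ⟨g, hg, rfl⟩, rfl⟩
    obtain ⟨h, rfl⟩ := e.surjective g
    exact ⟨h, fun h0 => hg ((hbot _).1 h0), rfl⟩

end Refinement

end GroupGrading

/-! ### Triangular operators and rank-one idempotents on the diagonal -/

section TriangularEmbedding

variable {F : Type*} [Field F] {V : Type*} [AddCommGroup V] [Module F V]

theorem matrixUnit_apply {ι : Type*} (b : Module.Basis ι F V) (i j : ι) (v : V) :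
    matrixUnit b i j v = b.repr v j • b i := by
  simp [matrixUnit]

theorem repr_apply_eq_sum {ι : Type*} (b : Module.Basis ι F V) (t : Module.End F V) (v : V)
    (i : ι) : b.repr (t v) i = (b.repr v).sum fun k a => a * b.repr (t (b k)) i := by
  conv_lhs => rw [← b.linearCombination_repr v]
  simp [Finsupp.linearCombination_apply, Finsupp.sum, Finsupp.finsetSum_apply]

theorem repr_apply_top (b : Module.Basis ℕ F V) {t : Module.End F V}
    (ht : ∀ i j, j < i → b.repr (t (b j)) i = 0) {n : ℕ} {v : V}
    (hv : ∀ k, n < k → b.repr v k = 0) :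
    b.repr (t v) n = b.repr v n * b.repr (t (b n)) n := by
  rw [repr_apply_eq_sum, Finsupp.sum, Finset.sum_eq_single n]
  · intro k _ hk
    rcases lt_or_gt_of_ne hk with h | h
    · rw [ht n k h, mul_zero]
    · rw [hv k h, zero_mul]
  · intro hn
    rw [Finsupp.notMem_support_iff.1 hn, zero_mul]

theorem repr_apply_above (b : Module.Basis ℕ F V) {t : Module.End F V}
    (ht : ∀ i j, j < i → b.repr (t (b j)) i = 0) {n : ℕ} {v : V}
    (hv : ∀ k, n < k → b.repr v k = 0) {m : ℕ} (hm : n < m) : b.repr (t v) m = 0 := by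
  rw [repr_apply_eq_sum, Finsupp.sum]
  refine Finset.sum_eq_zero fun k _ => ?_
  rcases lt_or_ge n k with h | h
  · rw [hv k h, zero_mul]
  · rw [ht m k (h.trans_lt hm), mul_zero]

/-- A nonzero vector has a last nonzero coordinate. Triangular operators multiply that coordinate by
a diagonal entry, which is how diagonals control fixed vectors. -/
theorem eq_zero_of_repr_top (b : Module.Basis ℕ F V) {v : V}
    (h : ∀ n, (∀ k, n < k → b.repr v k = 0) → b.repr v n = 0) : v = 0 := by
  by_contra hv
  have hne : (b.repr v).support.Nonempty := by
    rw [Finsupp.support_nonempty_iff]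
    simpa using hv
  refine Finsupp.mem_support_iff.1 ((b.repr v).support.max'_mem hne) (h _ fun k hk => ?_)
  by_contra hk0
  exact absurd ((b.repr v).support.le_max' k (Finsupp.mem_support_iff.2 hk0)) (not_le.2 hk)

/-- A fixed vector of a triangular operator is zero if the diagonal entries of the operator vanish
on its support. -/
theorem eq_zero_of_apply_eq_self (b : Module.Basis ℕ F V) {t : Module.End F V}
    (ht : ∀ i j, j < i → b.repr (t (b j)) i = 0) {v : V} (hv : t v = v)
    (h : ∀ n, b.repr v n ≠ 0 → b.repr (t (b n)) n = 0) : v = 0 := by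
  refine eq_zero_of_repr_top b fun n hn => ?_
  by_contra h0
  have := repr_apply_top b ht hn
  rw [hv, h n h0, mul_zero] at this
  exact h0 this

/-- The difference of the two sides is again fixed by t, and its coordinates live strictly below n,
where the diagonal of t vanishes. -/
theorem eq_smul_of_apply_eq_self (b : Module.Basis ℕ F V) {t : Module.End F V}
    (ht : ∀ i j, j < i → b.repr (t (b j)) i = 0) (htt : t * t = t) {n : ℕ}
    (h0 : ∀ k, k < n → b.repr (t (b k)) k = 0) (h1 : b.repr (t (b n)) n = 1) {v : V}
    (hv : t v = v) (hvn : ∀ k, n < k → b.repr v k = 0) : v = b.repr v n • t (b n) := by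
  rw [← sub_eq_zero]
  refine eq_zero_of_apply_eq_self b ht ?_ fun k hk => ?_
  · rw [map_sub, map_smul, hv, ← Module.End.mul_apply, htt]
  · rcases lt_trichotomy k n with h | rfl | h
    · exact h0 k h
    · exact absurd (by simp [h1]) hk
    · exact absurd (by simp [hvn k h, ht k n h]) hk

/-- A faithful representation of an algebra by triangular operators whose image contains the
matrix units. -/
structure TriangularEmbedding (b : Module.Basis ℕ F V) (A : Type*) [NonUnitalRing A]
    [Module F A] where
  /-- the representation -/
  toLin : A →ₗ[F] Module.End F V
  map_mul : ∀ x y, toLin (x * y) = toLin x * toLin y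
  injective : Function.Injective toLin
  triangular : ∀ x i j, j < i → b.repr (toLin x (b j)) i = 0
  exists_unit : ∀ i j, i ≤ j → ∃ a, toLin a = matrixUnit b i j

namespace TriangularEmbedding

variable {b : Module.Basis ℕ F V} {A : Type*} [NonUnitalRing A] [Module F A]

/-- The `n`-th diagonal entry. -/
noncomputable def diag (ρ : TriangularEmbedding b A) (n : ℕ) : A →ₗ[F] F :=
  b.coord n ∘ₗ LinearMap.applyₗ (b n) ∘ₗ ρ.toLin

theorem diag_apply (ρ : TriangularEmbedding b A) (n : ℕ) (x : A) :
    ρ.diag n x = b.repr (ρ.toLin x (b n)) n := rfl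

theorem diag_mul (ρ : TriangularEmbedding b A) (n : ℕ) (x y : A) :
    ρ.diag n (x * y) = ρ.diag n x * ρ.diag n y := by
  rw [diag_apply, ρ.map_mul, Module.End.mul_apply,
    repr_apply_top b (ρ.triangular x) fun k hk => ρ.triangular y k n hk, mul_comm]
  rfl

theorem diag_eq_zero_or_one (ρ : TriangularEmbedding b A) (n : ℕ) {x : A} (hx : x * x = x) :
    ρ.diag n x = 0 ∨ ρ.diag n x = 1 := by
  have h := ρ.diag_mul n x x
  rw [hx] at h
  rcases eq_or_ne (ρ.diag n x) 0 with h0 | h0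
  · exact Or.inl h0
  · exact Or.inr (mul_left_cancel₀ h0 (by rw [← h, mul_one]))

/-- An idempotent with zero diagonal is zero. -/
theorem eq_zero_of_diag_eq_zero (ρ : TriangularEmbedding b A) {x : A} (hx : x * x = x)
    (h : ∀ n, ρ.diag n x = 0) : x = 0 := by
  refine ρ.injective (LinearMap.ext fun v => ?_)
  rw [map_zero, LinearMap.zero_apply]
  refine eq_zero_of_apply_eq_self b (ρ.triangular x) ?_ fun n _ => h n
  rw [← Module.End.mul_apply, ← ρ.map_mul, hx]

variable {G : Type*} [Group G]

/-- The corner of a homogeneous idempotent `ε` of degree `1`, whose first nonzero diagonal entry is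
the `n`-th one, contains a homogeneous idempotent of rank one with this diagonal entry. -/
theorem exists_rank_one [IsScalarTower F A A] [SMulCommClass F A A]
    (ρ : TriangularEmbedding b A) (Γ : GroupGrading F G A) {ε : A} (hε : ε ∈ Γ.component 1)
    (hεε : ε * ε = ε) {n : ℕ} (h0 : ∀ k, k < n → ρ.diag k ε = 0) (h1 : ρ.diag n ε = 1) :
    ∃ f ∈ Γ.component 1, ε * f = f ∧ f * ε = f ∧ f * f = f ∧ ρ.diag n f = 1 ∧
      ∀ v, ρ.toLin f v = b.repr (ρ.toLin f v) n • ρ.toLin f (b n) := by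
  have hρε : ρ.toLin ε * ρ.toLin ε = ρ.toLin ε := by rw [← ρ.map_mul, hεε]
  have hfix : ∀ {x : A}, ε * x = x → ∀ v, ρ.toLin ε (ρ.toLin x v) = ρ.toLin x v :=
    fun {x} hx v => by rw [← Module.End.mul_apply, ← ρ.map_mul, hx]
  have hsm : ∀ {v : V}, ρ.toLin ε v = v → (∀ k, n < k → b.repr v k = 0) →
      v = b.repr v n • ρ.toLin ε (b n) :=
    eq_smul_of_apply_eq_self b (ρ.triangular ε) hρε h0 h1
  -- the corner acts through the diagonal entry on elements with zero rows below the `n`-th one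
  have hact : ∀ x, ε * x = x → (∀ j k, n < k → b.repr (ρ.toLin x (b j)) k = 0) →
      ∀ a, ε * a = a → a * ε = a → a * x = ρ.diag n a • x := by
    intro x hx hrow a ha₁ ha₂
    refine ρ.injective (b.ext fun j => ?_)
    have h2 := hsm (hfix hx (b j)) (hrow j)
    have h3 : ρ.toLin a (ρ.toLin ε (b n)) = ρ.diag n a • ρ.toLin ε (b n) := by
      rw [← Module.End.mul_apply, ← ρ.map_mul, ha₂]
      exact hsm (hfix ha₁ _) fun k hk => ρ.triangular a k n hk
    rw [ρ.map_mul, Module.End.mul_apply, map_smul, LinearMap.smul_apply, h2, map_smul, h3,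
      smul_comm]
  have hunit : ∀ j, n ≤ j → ∃ r, ε * r = r ∧ r * ε = r ∧
      ∀ v, ρ.toLin r v = b.repr (ρ.toLin ε v) j • ρ.toLin ε (b n) := by
    intro j hj
    obtain ⟨e, he⟩ := ρ.exists_unit n j hj
    -- The witness ε e_nj ε has rank at most one and reads off the j-th coordinate of εv. For j = n
    -- it serves as q; for j > n its n-th diagonal entry is zero.
    refine ⟨ε * e * ε, by rw [← mul_assoc, ← mul_assoc, hεε], by rw [mul_assoc _ ε, hεε],
      fun v => ?_⟩
    rw [ρ.map_mul, ρ.map_mul, Module.End.mul_apply, Module.End.mul_apply, he, matrixUnit_apply,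
      map_smul]
  have hrow : ∀ {r : A} {j : ℕ},
      (∀ v, ρ.toLin r v = b.repr (ρ.toLin ε v) j • ρ.toLin ε (b n)) →
        ∀ i k, n < k → b.repr (ρ.toLin r (b i)) k = 0 := by
    intro r j hr i k hk
    rw [hr, map_smul, Finsupp.smul_apply, ρ.triangular ε k n hk, smul_zero]
  have h1' : b.repr (ρ.toLin ε (b n)) n = 1 := h1
  obtain ⟨q, hq₁, hq₂, hq⟩ := hunit n le_rfl
  have hχq : ρ.diag n q = 1 := by
    rw [diag_apply, hq, map_smul, Finsupp.smul_apply, h1', smul_eq_mul, one_mul]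
  have hC : ∀ x, ε * x = x → x * ε = x →
      (∀ r, ε * r = r → r * ε = r → ρ.diag n r = 0 →
        (∀ a, ε * a = a → a * ε = a → a * r = ρ.diag n a • r) → r * x = 0) →
      ∀ a, ε * a = a → a * ε = a → a * x = ρ.diag n a • x := by
    intro x hx₁ hx₂ hx
    refine hact x hx₁ fun i j hj => ?_
    obtain ⟨r, hr₁, hr₂, hr⟩ := hunit j hj.le
    have hr0 : ρ.diag n r = 0 := by
      rw [diag_apply, hr, ρ.triangular ε j n hj, zero_smul, map_zero, Finsupp.zero_apply]
    -- As r reads off row j, r x = 0 says that row j of x vanishes.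
    have h2 := congrArg (fun t => b.repr (ρ.toLin t (b i)) n)
      (hx r hr₁ hr₂ hr0 (hact r hr₁ (hrow hr)))
    simpa [ρ.map_mul, hr, hfix hx₁, h1'] using h2
  obtain ⟨f, hf, hf₁, hf₂, hff, hχf, hfa⟩ := Γ.exists_homogeneous_idempotent hε (ρ.diag n)
    (ρ.diag_mul n) hq₁ hq₂ hχq (hact q hq₁ (hrow hq)) hC
  -- Since χ(q) = 1, f = q f, so the image of f lies in that of q, the line through ε b_n.
  have hqf : ∀ v, ρ.toLin f v = b.repr (ρ.toLin f v) n • ρ.toLin ε (b n) := by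
    intro v
    conv_lhs => rw [← one_smul F f, ← hχq, ← hfa q hq₁ hq₂, ρ.map_mul, Module.End.mul_apply, hq,
      hfix hf₁]
  refine ⟨f, hf, hf₁, hf₂, hff, hχf, fun v => ?_⟩
  have hfn : ρ.toLin f (b n) = ρ.toLin ε (b n) := by
    rw [hqf (b n), ← diag_apply, hχf, one_smul]
  rw [hfn]
  exact hqf v

/-- A family of orthogonal homogeneous idempotents of rank one and degree `1`, indexed by the
positions of their nonzero diagonal entries. -/
structure IdempotentFamily (ρ : TriangularEmbedding b A) (Γ : GroupGrading F G A) (D : Set ℕ)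
    (f : ℕ → A) : Prop where
  mem : ∀ i ∈ D, f i ∈ Γ.component 1
  mul_self : ∀ i ∈ D, f i * f i = f i
  mul_of_ne : ∀ i ∈ D, ∀ j ∈ D, i ≠ j → f i * f j = 0
  diag_self : ∀ i ∈ D, ρ.diag i (f i) = 1
  rank_one : ∀ i ∈ D, ∀ v, ρ.toLin (f i) v =
    b.repr (ρ.toLin (f i) v) i • ρ.toLin (f i) (b i)

namespace IdempotentFamily

variable {ρ : TriangularEmbedding b A} {Γ : GroupGrading F G A} {f : ℕ → A}

theorem toLin_eq_zero {D : Set ℕ} (h : IdempotentFamily ρ Γ D f) {i k : ℕ} (hi : i ∈ D)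
    (hk : k < i) : ρ.toLin (f i) (b k) = 0 := by
  rw [h.rank_one i hi, ρ.triangular (f i) i k hk, zero_smul]

/-- The image of f_i is the line through f_i b_i, which has no coordinates beyond i, and f_i kills
every b_k with k < i. -/
theorem diag_of_ne {D : Set ℕ} (h : IdempotentFamily ρ Γ D f) {i k : ℕ} (hi : i ∈ D)
    (hk : i ≠ k) : ρ.diag k (f i) = 0 := by
  rw [diag_apply]
  rcases lt_or_gt_of_ne hk with hk | hk
  · rw [h.rank_one i hi, map_smul, Finsupp.smul_apply, ρ.triangular (f i) k i hk, smul_zero]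
  · rw [h.toLin_eq_zero hi hk, map_zero, Finsupp.zero_apply]

theorem diag_sum {D : Finset ℕ} (h : IdempotentFamily ρ Γ D f) (k : ℕ) :
    ρ.diag k (∑ i ∈ D, f i) = if k ∈ D then 1 else 0 := by
  rw [map_sum]
  split_ifs with hk
  · rw [Finset.sum_eq_single k (fun i hi hik => h.diag_of_ne hi hik) fun hk' => absurd hk hk',
      h.diag_self k hk]
  · refine Finset.sum_eq_zero fun i hi => h.diag_of_ne hi ?_
    rintro rfl
    exact hk hi

theorem mul_sum {D : Finset ℕ} (h : IdempotentFamily ρ Γ D f) {k : ℕ} (hk : k ∈ D) :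
    f k * ∑ i ∈ D, f i = f k := by
  rw [Finset.mul_sum, Finset.sum_eq_single k (fun i hi hik => h.mul_of_ne k hk i hi hik.symm)
    fun hk' => absurd hk hk', h.mul_self k hk]

theorem sum_mul {D : Finset ℕ} (h : IdempotentFamily ρ Γ D f) {k : ℕ} (hk : k ∈ D) :
    (∑ i ∈ D, f i) * f k = f k := by
  rw [Finset.sum_mul, Finset.sum_eq_single k (fun i hi hik => h.mul_of_ne i hi k hk hik)
    fun hk' => absurd hk hk', h.mul_self k hk]

theorem sum_mul_sum {D : Finset ℕ} (h : IdempotentFamily ρ Γ D f) :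
    (∑ i ∈ D, f i) * ∑ i ∈ D, f i = ∑ i ∈ D, f i := by
  conv_lhs => rw [Finset.sum_mul]
  exact Finset.sum_congr rfl fun k hk => h.mul_sum hk

theorem sum_mem {D : Finset ℕ} (h : IdempotentFamily ρ Γ D f) :
    ∑ i ∈ D, f i ∈ Γ.component 1 :=
  Submodule.sum_mem _ fun i hi => h.mem i hi

theorem congr {D : Set ℕ} (h : IdempotentFamily ρ Γ D f) {g : ℕ → A} (hg : ∀ i ∈ D, g i = f i) :
    IdempotentFamily ρ Γ D g where
  mem i hi := hg i hi ▸ h.mem i hi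
  mul_self i hi := by rw [hg i hi, h.mul_self i hi]
  mul_of_ne i hi j hj hij := by rw [hg i hi, hg j hj, h.mul_of_ne i hi j hj hij]
  diag_self i hi := by rw [hg i hi, h.diag_self i hi]
  rank_one i hi v := by rw [hg i hi]; exact h.rank_one i hi v

/-- Removing the family deletes exactly the diagonal entries of E at D: the relation E f_k = f_k and
multiplicativity of the diagonal force those entries to be 1. -/
theorem diag_sub {D : Finset ℕ} (h : IdempotentFamily ρ Γ D f) {E : A}
    (hE : ∀ i ∈ D, E * f i = f i) (k : ℕ) :
    ρ.diag k (E - ∑ i ∈ D, f i) = if k ∈ D then 0 else ρ.diag k E := by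
  rw [map_sub, h.diag_sum]
  split_ifs with hk
  · have := ρ.diag_mul k E (f k)
    rw [hE k hk, h.diag_self k hk, mul_one] at this
    rw [← this, sub_self]
  · rw [sub_zero]

theorem sub_mul_sub {D : Finset ℕ} (h : IdempotentFamily ρ Γ D f) {E : A} (hEE : E * E = E)
    (hE : ∀ i ∈ D, E * f i = f i) (hE' : ∀ i ∈ D, f i * E = f i) :
    (E - ∑ i ∈ D, f i) * (E - ∑ i ∈ D, f i) = E - ∑ i ∈ D, f i := by
  have h1 : E * ∑ i ∈ D, f i = ∑ i ∈ D, f i := by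
    rw [Finset.mul_sum]; exact Finset.sum_congr rfl hE
  have h2 : (∑ i ∈ D, f i) * E = ∑ i ∈ D, f i := by
    rw [Finset.sum_mul]; exact Finset.sum_congr rfl hE'
  rw [sub_mul, mul_sub, mul_sub, h1, h2, hEE, h.sum_mul_sum, sub_self, sub_zero]

/-- The idempotent E - ∑ f_i is orthogonal to the family and n is its first nonzero diagonal
position, so a rank-one idempotent can be taken from its corner. D may already contain positions
beyond n. -/
theorem exists_insert [IsScalarTower F A A] [SMulCommClass F A A] {D : Finset ℕ}
    (h : IdempotentFamily ρ Γ D f) {E : A} (hE1 : E ∈ Γ.component 1) (hEE : E * E = E)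
    (hE : ∀ i ∈ D, E * f i = f i) (hE' : ∀ i ∈ D, f i * E = f i) {n : ℕ} (hn : n ∉ D)
    (hlt : ∀ k, k < n → ρ.diag k E ≠ 0 → k ∈ D) (hEn : ρ.diag n E ≠ 0) :
    ∃ g, (∀ i ∈ D, g i = f i) ∧ IdempotentFamily ρ Γ (insert n D : Finset ℕ) g ∧
      (∀ i ∈ insert n D, E * g i = g i) ∧ ∀ i ∈ insert n D, g i * E = g i := by
  obtain ⟨e, he, he₁, he₂, hee, hen, her⟩ := ρ.exists_rank_one Γ
    (Submodule.sub_mem _ hE1 h.sum_mem) (h.sub_mul_sub hEE hE hE') (n := n)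
    (fun k hk => by
      rw [h.diag_sub hE]
      split_ifs with hkD
      · rfl
      · by_contra h0
        exact hkD (hlt k hk h0))
    (by rw [h.diag_sub hE, if_neg hn]
        exact (ρ.diag_eq_zero_or_one n hEE).resolve_left hEn)
  have hl : ∀ i ∈ D, f i * e = 0 := fun i hi => by
    rw [← he₁, ← mul_assoc, mul_sub, hE' i hi, h.mul_sum hi, sub_self, zero_mul]
  have hr : ∀ i ∈ D, e * f i = 0 := fun i hi => by
    rw [← he₂, mul_assoc, sub_mul, hE i hi, h.sum_mul hi, sub_self, mul_zero]
  have hEe : E * e = e := by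
    rw [← he₁, ← mul_assoc, mul_sub, hEE, Finset.mul_sum, Finset.sum_congr rfl hE]
  have heE : e * E = e := by
    rw [← he₂, mul_assoc, sub_mul, hEE, Finset.sum_mul, Finset.sum_congr rfl hE']
  have hg : ∀ i ∈ D, Function.update f n e i = f i := fun i hi =>
    Function.update_of_ne (by rintro rfl; exact hn hi) _ _
  have hgn : Function.update f n e n = e := Function.update_self _ _ _
  have h' := h.congr hg
  refine ⟨Function.update f n e, hg, ⟨?_, ?_, ?_, ?_, ?_⟩, ?_, ?_⟩ <;>
    simp only [Finset.coe_insert, Set.forall_mem_insert, Finset.forall_mem_insert, hgn,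
      Finset.mem_coe]
  · exact ⟨he, h'.mem⟩
  · exact ⟨hee, h'.mul_self⟩
  · refine ⟨⟨fun hne => absurd rfl hne, fun j hj _ => ?_⟩, fun i hi => ⟨fun _ => ?_, ?_⟩⟩
    · rw [hg j hj, hr j hj]
    · rw [hg i hi, hl i hi]
    · exact h'.mul_of_ne i hi
  · exact ⟨hen, h'.diag_self⟩
  · exact ⟨her, h'.rank_one⟩
  · exact ⟨hEe, fun i hi => by rw [hg i hi, hE i hi]⟩
  · exact ⟨heE, fun i hi => by rw [hg i hi, hE' i hi]⟩

/-- A family below a homogeneous idempotent `E` can be extended to any finite number of positions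
at which the diagonal entry of `E` is not zero. -/
theorem exists_extension [IsScalarTower F A A] [SMulCommClass F A A] {D : Finset ℕ}
    (h : IdempotentFamily ρ Γ D f) {E : A} (hE1 : E ∈ Γ.component 1) (hEE : E * E = E)
    (hE : ∀ i ∈ D, E * f i = f i) (hE' : ∀ i ∈ D, f i * E = f i) (N : ℕ) :
    ∃ (D' : Finset ℕ) (g : ℕ → A), D ⊆ D' ∧ (∀ i ∈ D, g i = f i) ∧ IdempotentFamily ρ Γ D' g ∧
      (∀ i ∈ D', E * g i = g i) ∧ (∀ i ∈ D', g i * E = g i) ∧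
      ∀ k, k < N → ρ.diag k E ≠ 0 → k ∈ D' := by
  induction N with
  | zero => exact ⟨D, f, subset_rfl, fun _ _ => rfl, h, hE, hE', fun k hk => absurd hk (by simp)⟩
  | succ N ih =>
    obtain ⟨D', g, hD, hg, hfam, hl, hr, hN⟩ := ih
    by_cases hc : N ∈ D' ∨ ρ.diag N E = 0
    · refine ⟨D', g, hD, hg, hfam, hl, hr, fun k hk hk0 => ?_⟩
      rcases Nat.lt_succ_iff_lt_or_eq.1 hk with hk | rfl
      · exact hN k hk hk0
      · exact hc.resolve_right hk0
    · push Not at hc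
      obtain ⟨g', hg', hfam', hl', hr'⟩ := hfam.exists_insert hE1 hEE hl hr hc.1 hN hc.2
      refine ⟨insert N D', g', hD.trans (Finset.subset_insert _ _),
        fun i hi => (hg' i (hD hi)).trans (hg i hi), hfam', hl', hr', fun k hk hk0 => ?_⟩
      rcases Nat.lt_succ_iff_lt_or_eq.1 hk with hk | rfl
      · exact Finset.mem_insert_of_mem (hN k hk hk0)
      · exact Finset.mem_insert_self _ _

/-- If every finite family can be extended so as to contain a given position and to have a
further property, then there is a family with all positions that is exhausted by finite families
with these properties. -/
theorem exists_univ (ρ : TriangularEmbedding b A) (Γ : GroupGrading F G A)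
    {P : ℕ → A → Prop} (hstep : ∀ (D : Finset ℕ) (f : ℕ → A) (m : ℕ), IdempotentFamily ρ Γ D f →
      ∃ (D' : Finset ℕ) (g : ℕ → A), D ⊆ D' ∧ (∀ i ∈ D, g i = f i) ∧ IdempotentFamily ρ Γ D' g ∧
        m ∈ D' ∧ P m (∑ i ∈ D', g i)) :
    ∃ f, IdempotentFamily ρ Γ Set.univ f ∧ ∀ m, ∃ D : Finset ℕ, P m (∑ i ∈ D, f i) := by
  -- Iterate the extension, adding position n at stage n. Values already chosen never change, so the
  -- limit family takes its i-th member from stage i + 1, the first stage guaranteed to contain i.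
  let S := {p : Finset ℕ × (ℕ → A) // IdempotentFamily ρ Γ p.1 p.2}
  have hstep' : ∀ (m : ℕ) (s : S), ∃ s' : S, s.1.1 ⊆ s'.1.1 ∧ (∀ i ∈ s.1.1, s'.1.2 i = s.1.2 i) ∧
      m ∈ s'.1.1 ∧ P m (∑ i ∈ s'.1.1, s'.1.2 i) := by
    rintro m ⟨⟨D, f⟩, h⟩
    obtain ⟨D', g, h1, h2, h3, h4, h5⟩ := hstep D f m h
    exact ⟨⟨(D', g), h3⟩, h1, h2, h4, h5⟩
  choose next hn₁ hn₂ hn₃ hn₄ using hstep'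
  let s₀ : S := ⟨(∅, 0), by constructor <;> simp⟩
  let s : ℕ → S := fun n => Nat.rec s₀ next n
  have hs : ∀ n, s (n + 1) = next n (s n) := fun _ => rfl
  have hmono : Monotone fun n => (s n).1.1 := monotone_nat_of_le_succ fun n => by
    rw [hs]; exact hn₁ n (s n)
  have hcoh : ∀ m n, m ≤ n → ∀ i ∈ (s m).1.1, (s n).1.2 i = (s m).1.2 i := by
    intro m n hmn
    induction n, hmn using Nat.le_induction with
    | base => exact fun _ _ => rfl
    | succ n hmn ih =>
      intro i hi
      rw [hs, hn₂ n (s n) i (hmono hmn hi), ih i hi]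
  have hmem : ∀ m, m ∈ (s (m + 1)).1.1 := fun m => by rw [hs]; exact hn₃ m (s m)
  have hf : ∀ n, ∀ i ∈ (s n).1.1, (s (i + 1)).1.2 i = (s n).1.2 i := by
    intro n i hi
    rcases le_total (i + 1) n with hin | hin
    · exact (hcoh _ _ hin i (hmem i)).symm
    · exact hcoh _ _ hin i hi
  have hfam : ∀ n, IdempotentFamily ρ Γ (s n).1.1 fun i => (s (i + 1)).1.2 i :=
    fun n => (s n).2.congr (hf n)
  refine ⟨fun i => (s (i + 1)).1.2 i, ⟨fun i _ => (hfam (i + 1)).mem i (hmem i),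
    fun i _ => (hfam (i + 1)).mul_self i (hmem i), fun i _ j _ hij => ?_,
    fun i _ => (hfam (i + 1)).diag_self i (hmem i), fun i _ => (hfam (i + 1)).rank_one i (hmem i)⟩,
    fun m => ⟨(s (m + 1)).1.1, ?_⟩⟩
  · exact (hfam (max i j + 1)).mul_of_ne i (hmono (Nat.succ_le_succ (le_max_left i j)) (hmem i)) j
      (hmono (Nat.succ_le_succ (le_max_right i j)) (hmem j)) hij
  · rw [Finset.sum_congr rfl (hf (m + 1)), hs]
    exact hn₄ m (s m)

end IdempotentFamily

end TriangularEmbedding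

end TriangularEmbedding

/-! ### Bases adapted to a grading -/

section AdaptedBasis

variable {F : Type*} [Field F] {V : Type*} [AddCommGroup V] [Module F V]

theorem mem_span_Iic_iff (b : Module.Basis ℕ F V) {j : ℕ} {v : V} :
    v ∈ Submodule.span F (b '' Set.Iic j) ↔ ∀ k, j < k → b.repr v k = 0 := by
  rw [Module.Basis.mem_span_image]
  constructor
  · intro h k hk
    by_contra h0
    exact absurd (h (Finsupp.mem_support_iff.2 h0)) (not_le.2 hk)
  · intro h k hk
    by_contra h0
    exact Finsupp.mem_support_iff.1 hk (h k (not_le.1 h0))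

theorem mem_upperTriangular_iff (b : Module.Basis ℕ F V) {t : Module.End F V} :
    t ∈ upperTriangular b ↔ ∀ i j, j < i → b.repr (t (b j)) i = 0 := by
  refine ⟨fun h i j hij => (mem_span_Iic_iff b).1 (h j) i hij, fun h j => ?_⟩
  exact (mem_span_Iic_iff b).2 fun i hij => h i j hij

theorem upperTriangular_le_of_span_eq {ι : Type*} [Preorder ι] {b c : Module.Basis ι F V}
    (h : ∀ j, Submodule.span F (c '' Set.Iic j) = Submodule.span F (b '' Set.Iic j)) :
    upperTriangular b ≤ upperTriangular c := by
  intro t ht j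
  have key : Submodule.span F (b '' Set.Iic j) ≤
      (Submodule.span F (b '' Set.Iic j)).comap t := by
    rw [Submodule.span_le]
    rintro _ ⟨i, hi, rfl⟩
    exact Submodule.span_mono (Set.image_mono (Set.Iic_subset_Iic.2 hi)) (ht i)
  rw [h]
  exact key (h j ▸ Submodule.subset_span ⟨j, le_rfl, rfl⟩)

theorem upperTriangular_eq_of_span_eq {ι : Type*} [Preorder ι] {b c : Module.Basis ι F V}
    (h : ∀ j, Submodule.span F (c '' Set.Iic j) = Submodule.span F (b '' Set.Iic j)) :
    upperTriangular c = upperTriangular b :=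
  (upperTriangular_le_of_span_eq fun j => (h j).symm).antisymm (upperTriangular_le_of_span_eq h)

theorem matrixUnit_mem_upperTriangular {ι : Type*} [Preorder ι] (b : Module.Basis ι F V)
    {i j : ι} (hij : i ≤ j) : matrixUnit b i j ∈ upperTriangular b := by
  intro k
  rw [matrixUnit_apply]
  by_cases hk : k = j
  · subst hk
    exact Submodule.smul_mem _ _ (Submodule.subset_span ⟨i, hij, rfl⟩)
  · simp [hk]

theorem matrixUnit_mem_upperTriangularLim {ι : Type*} [Preorder ι] (b : Module.Basis ι F V)
    {i j : ι} (hij : i ≤ j) : matrixUnit b i j ∈ upperTriangularLim b :=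
  Submodule.subset_span ⟨i, j, hij, rfl⟩

theorem upperTriangularLim_induction {ι : Type*} [Preorder ι] {b : Module.Basis ι F V}
    {p : Submodule F (Module.End F V)} (h : ∀ i j, i ≤ j → matrixUnit b i j ∈ p)
    {t : Module.End F V} (ht : t ∈ upperTriangularLim b) : t ∈ p := by
  have : Submodule.span F {t | ∃ i j, i ≤ j ∧ t = matrixUnit b i j} ≤ p := by
    rw [Submodule.span_le]
    rintro _ ⟨i, j, hij, rfl⟩
    exact h i j hij
  exact this ht

theorem upperTriangularLim_le_upperTriangular {ι : Type*} [Preorder ι] (b : Module.Basis ι F V)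
    {t : Module.End F V} (ht : t ∈ upperTriangularLim b) : t ∈ upperTriangular b :=
  upperTriangularLim_induction (p := (upperTriangular b).toSubmodule)
    (fun _ _ hij => matrixUnit_mem_upperTriangular b hij) ht

theorem smulRight_mem_upperTriangularLim (b : Module.Basis ℕ F V) {j : ℕ} {v : V}
    (hv : v ∈ Submodule.span F (b '' Set.Iic j)) :
    (b.coord j).smulRight v ∈ upperTriangularLim b := by
  have : Submodule.span F (b '' Set.Iic j) ≤ (upperTriangularLim b).toSubmodule.comap
      (LinearMap.smulRightₗ (b.coord j)) := by
    rw [Submodule.span_le]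
    rintro _ ⟨i, hi, rfl⟩
    exact matrixUnit_mem_upperTriangularLim b hi
  exact this hv

theorem sum_matrixUnit_apply (b : Module.Basis ℕ F V) (N j : ℕ) :
    (∑ i ∈ Finset.range N, matrixUnit b i i) (b j) = if j < N then b j else 0 := by
  simp [LinearMap.sum_apply, matrixUnit_apply, Finsupp.single_apply, ite_smul]

/-- The algebra `upperTriangularLim b` consists of the triangular operators that vanish on all but
finitely many vectors of the basis. -/
theorem mem_upperTriangularLim_iff (b : Module.Basis ℕ F V) {t : Module.End F V} :
    t ∈ upperTriangularLim b ↔ t ∈ upperTriangular b ∧ ∃ N, ∀ j, N ≤ j → t (b j) = 0 := by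
  constructor
  · refine fun ht => ⟨upperTriangularLim_le_upperTriangular b ht, ?_⟩
    let p : Submodule F (Module.End F V) :=
      { carrier := {t | ∃ N, ∀ j, N ≤ j → t (b j) = 0}
        add_mem' := by
          rintro s t ⟨M, hM⟩ ⟨N, hN⟩
          refine ⟨max M N, fun j hj => ?_⟩
          rw [LinearMap.add_apply, hM j (le_of_max_le_left hj), hN j (le_of_max_le_right hj),
            add_zero]
        zero_mem' := ⟨0, fun _ _ => rfl⟩
        smul_mem' := by
          rintro c t ⟨N, hN⟩
          exact ⟨N, fun j hj => by rw [LinearMap.smul_apply, hN j hj, smul_zero]⟩ }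
    refine upperTriangularLim_induction (p := p) (fun i j _ => ⟨j + 1, fun k hk => ?_⟩) ht
    exact matrixUnit_apply_of_ne b i (by omega)
  · rintro ⟨ht, N, hN⟩
    have key : t = ∑ j ∈ Finset.range N, (b.coord j).smulRight (t (b j)) := by
      refine b.ext fun k => ?_
      simp only [LinearMap.sum_apply, LinearMap.smulRight_apply, Module.Basis.coord_apply,
        Module.Basis.repr_self, Finsupp.single_apply, ite_smul, one_smul, zero_smul,
        Finset.sum_ite_eq, Finset.mem_range]
      split_ifs with hk
      · rfl
      · exact hN k (not_lt.1 hk)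
    rw [key]
    exact sum_mem fun j _ => smulRight_mem_upperTriangularLim b (ht j)

namespace TriangularEmbedding

/-- The inclusion of the algebra of all triangular operators. -/
def ofUpperTriangular (b : Module.Basis ℕ F V) : TriangularEmbedding b (upperTriangular b) where
  toLin := (upperTriangular b).val.toLinearMap
  map_mul _ _ := rfl
  injective := Subtype.val_injective
  triangular x := (mem_upperTriangular_iff b).1 x.2
  exists_unit _ _ hij := ⟨⟨_, matrixUnit_mem_upperTriangular b hij⟩, rfl⟩

/-- The inclusion of the direct limit of the algebras of triangular matrices. -/
def ofUpperTriangularLim (b : Module.Basis ℕ F V) :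
    TriangularEmbedding b (upperTriangularLim b) where
  toLin := (upperTriangularLim b).toSubmodule.subtype
  map_mul _ _ := rfl
  injective := Subtype.val_injective
  triangular x := (mem_upperTriangular_iff b).1 (upperTriangularLim_le_upperTriangular b x.2)
  exists_unit _ _ hij := ⟨⟨_, matrixUnit_mem_upperTriangularLim b hij⟩, rfl⟩

variable {b : Module.Basis ℕ F V} {A : Type*} [NonUnitalRing A] [Module F A]
variable {G : Type*} [Group G]

/-- The homogeneous idempotents of a complete family are the diagonal matrix units of a basis
that spans the same flag. -/
theorem IdempotentFamily.exists_basis {ρ : TriangularEmbedding b A} {Γ : GroupGrading F G A}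
    {f : ℕ → A} (h : IdempotentFamily ρ Γ Set.univ f) :
    ∃ c : Module.Basis ℕ F V,
      (∀ j, Submodule.span F (c '' Set.Iic j) = Submodule.span F (b '' Set.Iic j)) ∧
      ∀ i, ρ.toLin (f i) = matrixUnit c i i := by
  let w : ℕ → V := fun i => ρ.toLin (f i) (b i)
  have hw : ∀ i j, ρ.toLin (f i) (w j) = if i = j then w i else 0 := by
    intro i j
    change ρ.toLin (f i) (ρ.toLin (f j) (b j)) = _
    rw [← Module.End.mul_apply, ← ρ.map_mul]
    split_ifs with hij
    · subst hij
      rw [h.mul_self i trivial]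
    · rw [h.mul_of_ne i trivial j trivial hij, map_zero, LinearMap.zero_apply]
  have hdiag : ∀ i, b.repr (w i) i = 1 := fun i => h.diag_self i trivial
  have hli : LinearIndependent F w := by
    refine LinearIndependent.of_pairwise_dual_eq_zero_one (M := V) w
      (fun i => b.coord i ∘ₗ ρ.toLin (f i)) (fun i j hij => ?_) fun i => ?_
    · simp [hw, hij]
    · simp [hw, hdiag]
  have hle : ∀ j, Submodule.span F (w '' Set.Iic j) ≤ Submodule.span F (b '' Set.Iic j) := by
    intro j
    rw [Submodule.span_le]
    rintro _ ⟨i, hi, rfl⟩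
    exact (mem_span_Iic_iff b).2 fun k hk => ρ.triangular (f i) k i (lt_of_le_of_lt hi hk)
  -- The transition from b to w is unitriangular, so it can be inverted by induction along the flag.
  have hb : ∀ j, b j ∈ Submodule.span F (w '' Set.Iic j) := by
    intro j
    induction j using Nat.strong_induction_on with
    | _ j ih =>
      have h1 : b j - w j ∈ Submodule.span F (b '' Set.Iio j) := by
        rw [Module.Basis.mem_span_image]
        intro k hk
        by_contra hkj
        rcases eq_or_lt_of_le (not_lt.1 (show ¬ k < j from hkj)) with rfl | hlt
        · exact Finsupp.mem_support_iff.1 hk (by simp [hdiag])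
        · refine Finsupp.mem_support_iff.1 hk ?_
          rw [map_sub, Finsupp.sub_apply, ρ.triangular (f j) k j hlt]
          simp [hlt.ne]
      have h2 : Submodule.span F (b '' Set.Iio j) ≤ Submodule.span F (w '' Set.Iic j) := by
        rw [Submodule.span_le]
        rintro _ ⟨i, hi, rfl⟩
        exact Submodule.span_mono (Set.image_mono (Set.Iic_subset_Iic.2 (le_of_lt hi))) (ih i hi)
      rw [← sub_add_cancel (b j) (w j)]
      exact Submodule.add_mem _ (h2 h1) (Submodule.subset_span ⟨j, Set.self_mem_Iic, rfl⟩)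
  have hge : ∀ j, Submodule.span F (b '' Set.Iic j) ≤ Submodule.span F (w '' Set.Iic j) := by
    intro j
    rw [Submodule.span_le]
    rintro _ ⟨i, hi, rfl⟩
    exact Submodule.span_mono (Set.image_mono (Set.Iic_subset_Iic.2 hi)) (hb i)
  have hsp : ⊤ ≤ Submodule.span F (Set.range w) := by
    rw [← b.span_eq, Submodule.span_le]
    rintro _ ⟨j, rfl⟩
    exact Submodule.span_mono (Set.image_subset_range _ _) (hb j)
  refine ⟨Module.Basis.mk hli hsp, fun j => ?_, fun i => (Module.Basis.mk hli hsp).ext fun j => ?_⟩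
  · rw [Module.Basis.coe_mk]
    exact (hle j).antisymm (hge j)
  · rw [matrixUnit_apply, Module.Basis.repr_self, Module.Basis.mk_apply, Module.Basis.mk_apply, hw]
    by_cases hij : i = j
    · simp [hij]
    · simp [hij]

/-- A matrix unit is homogeneous if the corresponding diagonal matrix units are homogeneous of
degree `1`. -/
theorem exists_degree (ρ : TriangularEmbedding b A) (Γ : GroupGrading F G A) {i j : ℕ}
    {x y a : A} (hx : x ∈ Γ.component 1) (hy : y ∈ Γ.component 1)
    (hρx : ρ.toLin x = matrixUnit b i i) (hρy : ρ.toLin y = matrixUnit b j j)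
    (ha : ρ.toLin a = matrixUnit b i j) : ∃ g, a ∈ Γ.component g := by
  have hne : a ≠ 0 := by
    rintro rfl
    have := congrArg (fun t => t (b j)) ha
    simp only [map_zero, LinearMap.zero_apply, matrixUnit_apply_self] at this
    exact b.ne_zero i this.symm
  obtain ⟨g, hg⟩ := Γ.exists_proj_ne_zero hne
  have hxay : x * a * y = a := ρ.injective (by
    rw [ρ.map_mul, ρ.map_mul, hρx, hρy, ha, matrixUnit_mul_same, matrixUnit_mul_same])
  have h1 : x * Γ.proj g a * y = Γ.proj g a := by
    rw [← Γ.proj_one_mul hx, ← Γ.proj_mul_one hy, hxay]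
  -- By `h1` the component lies in the corner between e_ii and e_jj, which is the line through a.
  have h2 : Γ.proj g a = b.repr (ρ.toLin (Γ.proj g a) (b j)) i • a := by
    refine ρ.injective (b.ext fun k => ?_)
    conv_lhs => rw [← h1]
    rw [map_smul, ha, ρ.map_mul, ρ.map_mul, hρx, hρy, Module.End.mul_apply, Module.End.mul_apply,
      matrixUnit_apply b j, map_smul, map_smul, LinearMap.smul_apply, matrixUnit_apply b i i,
      matrixUnit_apply b i j]
    exact smul_comm _ _ _
  refine ⟨g, ?_⟩
  have h3 : b.repr (ρ.toLin (Γ.proj g a) (b j)) i ≠ 0 := by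
    intro h0
    rw [h0, zero_smul] at h2
    exact hg h2
  rw [← inv_smul_smul₀ h3 a, ← h2]
  exact Submodule.smul_mem _ _ (Γ.proj_mem g a)

end TriangularEmbedding

/-- A nonzero difference δ_j - δ_i has its -1 at i and its +1 at j, so it determines the pair. This
makes labels in ℤ^ℕ as free as possible. -/
theorem single_sub_single_eq {i j k l : ℕ}
    (h : (Pi.single j 1 - Pi.single i 1 : ℕ → ℤ) = Pi.single l 1 - Pi.single k 1) :
    (i = j ∧ k = l) ∨ (i = k ∧ j = l) := by
  have hi := congrFun h i
  have hj := congrFun h j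
  have hl := congrFun h l
  simp only [Pi.sub_apply, Pi.single_apply] at hi hj hl
  split_ifs at hi hj hl <;> omega

theorem inv_deltaMap_mul_deltaMap_eq {i j k l : ℕ}
    (h : (deltaMap i)⁻¹ * deltaMap j = (deltaMap k)⁻¹ * deltaMap l) :
    (i = j ∧ k = l) ∨ (i = k ∧ j = l) := by
  refine single_sub_single_eq ?_
  have := congrArg Multiplicative.toAdd h
  simpa [deltaMap, neg_add_eq_sub] using this

end AdaptedBasis

/-! ### Finite proper refinements on the full triangular algebra -/

section TriangularGrading

variable {F : Type*} [Field F] {V : Type*} [AddCommGroup V] [Module F V]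

/-- The coordinate projection onto the span of the basis vectors that are labelled by `h`. -/
noncomputable def labelProjection {ι H : Type*} (c : Module.Basis ι F V) (κ : ι → H) (h : H) :
    Module.End F V :=
  open scoped Classical in c.constr F fun i => if κ i = h then c i else 0

open scoped Classical in
theorem labelProjection_apply {ι H : Type*} (c : Module.Basis ι F V) (κ : ι → H) (h : H) (i : ι) :
    labelProjection c κ h (c i) = if κ i = h then c i else 0 := by
  simp [labelProjection]

open scoped Classical in
theorem repr_labelProjection {ι H : Type*} (c : Module.Basis ι F V) (κ : ι → H) (h : H) (v : V)
    (i : ι) : c.repr (labelProjection c κ h v) i = if κ i = h then c.repr v i else 0 := by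
  rw [repr_apply_eq_sum, Finsupp.sum, Finset.sum_eq_single i]
  · rw [labelProjection_apply]
    split_ifs <;> simp
  · intro k _ hk
    rw [labelProjection_apply]
    split_ifs <;> simp [hk]
  · intro hi
    rw [Finsupp.notMem_support_iff.1 hi, zero_mul]

theorem labelProjection_mem_upperTriangular {ι H : Type*} [Preorder ι] (c : Module.Basis ι F V)
    (κ : ι → H) (h : H) : labelProjection c κ h ∈ upperTriangular c := by
  intro j
  rw [labelProjection_apply]
  split_ifs
  · exact Submodule.subset_span ⟨j, Set.self_mem_Iic, rfl⟩
  · exact Submodule.zero_mem _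

theorem sum_labelProjection {ι H : Type*} (c : Module.Basis ι F V) {κ : ι → H}
    {s : Finset H} (hs : ∀ i, κ i ∈ s) : ∑ h ∈ s, labelProjection c κ h = 1 := by
  classical
  refine c.ext fun i => ?_
  simp [LinearMap.sum_apply, labelProjection_apply, hs]

/-- The elementary grading on the algebra of all triangular operators that is defined by a
labelling of the basis vectors with finitely many labels. -/
noncomputable def triangularGrading {ι H : Type*} [Preorder ι] [Group H]
    (c : Module.Basis ι F V) (κ : ι → H) (hκ : (Set.range κ).Finite) :
    GroupGrading F H (upperTriangular c) where
  component h :=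
    { carrier := {t | ∀ i j, c.repr (t.1 (c j)) i ≠ 0 → (κ i)⁻¹ * κ j = h}
      add_mem' := by
        intro s t hs ht i j hij
        by_cases h0 : c.repr (s.1 (c j)) i = 0
        · refine ht i j fun h1 => hij ?_
          change c.repr (s.1 (c j) + t.1 (c j)) i = 0
          rw [map_add, Finsupp.add_apply, h0, h1, add_zero]
        · exact hs i j h0
      zero_mem' := fun i j hij => absurd (by simp) hij
      smul_mem' := by
        intro a t ht i j hij
        refine ht i j fun h1 => hij ?_
        change c.repr (a • t.1 (c j)) i = 0
        rw [map_smul, Finsupp.smul_apply, h1, smul_zero] }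
  iSupIndep_component := by
    intro h
    let p : Submodule F (upperTriangular c) :=
      { carrier := {t | ∀ i j, (κ i)⁻¹ * κ j = h → c.repr (t.1 (c j)) i = 0}
        add_mem' := by
          intro s t hs ht i j hij
          change c.repr (s.1 (c j) + t.1 (c j)) i = 0
          rw [map_add, Finsupp.add_apply, hs i j hij, ht i j hij, add_zero]
        zero_mem' := fun i j _ => by simp
        smul_mem' := by
          intro a t ht i j hij
          change c.repr (a • t.1 (c j)) i = 0
          rw [map_smul, Finsupp.smul_apply, ht i j hij, smul_zero] }
    refine Disjoint.mono_right (c := p) (iSup₂_le fun k hk t ht i j hij => ?_) ?_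
    · by_contra h0
      exact hk ((ht i j h0).symm.trans hij)
    · rw [Submodule.disjoint_def]
      intro t ht htp
      refine Subtype.ext (c.ext fun j => c.repr.injective (Finsupp.ext fun i => ?_))
      by_contra h0
      refine h0 ?_
      rw [htp i j (ht i j fun h1 => h0 (by rw [h1]; simp))]
      simp
  iSup_component := by
    rw [eq_top_iff]
    rintro t -
    let π : H → upperTriangular c := fun h => ⟨_, labelProjection_mem_upperTriangular c κ h⟩
    have hπ : ∑ h ∈ hκ.toFinset, π h = 1 := by
      refine Subtype.ext ?_
      rw [AddSubmonoidClass.coe_finsetSum]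
      exact sum_labelProjection c fun i => hκ.mem_toFinset.2 ⟨i, rfl⟩
    -- Finiteness of the label set matters here: t must be a finite sum of homogeneous blocks,
    -- although it may have infinitely many nonzero entries.
    have ht : t = ∑ g ∈ hκ.toFinset, ∑ h ∈ hκ.toFinset, π g * t * π h := by
      simp_rw [← Finset.mul_sum, ← Finset.sum_mul, hπ, one_mul, mul_one]
    rw [ht]
    refine Submodule.sum_mem _ fun g _ => Submodule.sum_mem _ fun h _ =>
      Submodule.mem_iSup_of_mem (g⁻¹ * h) fun i j hij => ?_
    change c.repr (labelProjection c κ g (t.1 (labelProjection c κ h (c j)))) i ≠ 0 at hij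
    rw [repr_labelProjection, labelProjection_apply] at hij
    split_ifs at hij with h1 h2
    · rw [h1, h2]
    · simp at hij
    · exact absurd rfl hij
  mul_mem := by
    intro g h s t hs ht i j hij
    change c.repr (s.1 (t.1 (c j))) i ≠ 0 at hij
    rw [repr_apply_eq_sum] at hij
    obtain ⟨k, -, hk⟩ := Finset.exists_ne_zero_of_sum_ne_zero hij
    rw [← hs i k (right_ne_zero_of_mul hk), ← ht k j (left_ne_zero_of_mul hk)]
    group

theorem isFinite_triangularGrading {ι H : Type*} [Preorder ι] [Group H]
    (c : Module.Basis ι F V) {κ : ι → H} (hκ : (Set.range κ).Finite) :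
    (triangularGrading c κ hκ).IsFinite := by
  refine (Set.Finite.image2 (fun g h => g⁻¹ * h) hκ hκ).subset fun h hh => ?_
  obtain ⟨t, ht, ht0⟩ := Submodule.exists_mem_ne_zero_of_ne_bot hh
  by_contra hn
  refine ht0 (Subtype.ext (c.ext fun j => c.repr.injective (Finsupp.ext fun i => ?_)))
  by_contra h0
  refine hn ⟨κ i, ⟨i, rfl⟩, κ j, ⟨j, rfl⟩, ht i j fun h1 => h0 ?_⟩
  rw [h1]
  simp

/-- If finitely many labels occur in a sequence, then two different terms with the same label can be
separated by a finer labelling with finitely many natural numbers. -/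
theorem exists_finer_labelling {G : Type*} {d : ℕ → G} (hd : (Set.range d).Finite) :
    ∃ (l : ℕ → ℕ) (m n : ℕ), (Set.range l).Finite ∧ (∀ i j, l i = l j → d i = d j) ∧ m < n ∧
      d m = d n ∧ l m ≠ l n := by
  obtain ⟨m, n, hmn, hdmn⟩ : ∃ m n, m < n ∧ d m = d n := by
    obtain ⟨m, -, n, -, hne, h⟩ := Set.infinite_univ.exists_ne_map_eq_of_mapsTo
      (fun i _ => Set.mem_range_self i) hd
    rcases lt_or_gt_of_ne hne with hlt | hlt
    · exact ⟨m, n, hlt, h⟩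
    · exact ⟨n, m, hlt, h.symm⟩
  -- Each old label is encoded by the least index carrying it; the shift by one below reserves 0 as
  -- the private label of m.
  let r : G → ℕ := fun g => sInf {k | d k = g}
  have hr : ∀ i, d (r (d i)) = d i := fun i => Nat.sInf_mem (s := {k | d k = d i}) ⟨i, rfl⟩
  refine ⟨fun i => if i = m then 0 else r (d i) + 1, m, n, ?_, ?_, hmn, hdmn, ?_⟩
  · refine ((hd.image fun g => r g + 1).insert 0).subset ?_
    rintro _ ⟨i, rfl⟩
    dsimp only
    split_ifs
    · exact Set.mem_insert _ _
    · exact Set.mem_insert_of_mem _ ⟨d i, ⟨i, rfl⟩, rfl⟩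
  · intro i j hij
    dsimp only at hij
    split_ifs at hij with h1 h2 h2
    · rw [h1, h2]
    · rw [← hr i, Nat.succ_injective hij, hr j]
  · simp [hmn.ne']

open TriangularEmbedding in
/-- A grading on the algebra of all triangular operators for which the diagonal matrix units are
homogeneous of degree `1` has a proper finite refinement. -/
theorem exists_finite_properRefinement_of_diagonal.{u₁} (c : Module.Basis ℕ F V) {G : Type*}
    [Group G] {S : Subalgebra F (Module.End F V)} (hS : S = upperTriangular c)
    (Γ : GroupGrading F G S) {f : ℕ → S} (hf : ∀ i, f i ∈ Γ.component 1)
    (hfc : ∀ i, (f i : Module.End F V) = matrixUnit c i i) :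
    ∃ (H : Type u₁) (_ : Group H) (Γ' : GroupGrading F H S),
      Γ'.IsFinite ∧ Γ'.IsProperRefinementOf Γ := by
  subst hS
  have hdeg : ∀ i j (hij : i ≤ j), ∃ g,
      (⟨_, matrixUnit_mem_upperTriangular c hij⟩ : upperTriangular c) ∈ Γ.component g :=
    fun i j hij => (ofUpperTriangular c).exists_degree Γ (hf i) (hf j) (hfc i) (hfc j) rfl
  let e : ∀ i j, i ≤ j → upperTriangular c :=
    fun i j hij => ⟨_, matrixUnit_mem_upperTriangular c hij⟩
  have hne : ∀ i j (hij : i ≤ j), e i j hij ≠ 0 := by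
    intro i j hij h0
    have := congrArg (fun t : upperTriangular c => t.1 (c j)) h0
    exact c.ne_zero i ((matrixUnit_apply_self c i j).symm.trans this)
  choose d hd using fun i => hdeg 0 i (Nat.zero_le i)
  have hd' : ∀ i j (hij : i ≤ j), e i j hij ∈ Γ.component ((d i)⁻¹ * d j) := by
    intro i j hij
    obtain ⟨g, hg⟩ := hdeg i j hij
    have h1 : e 0 i (Nat.zero_le i) * e i j hij = e 0 j (Nat.zero_le j) :=
      Subtype.ext (matrixUnit_mul_same c 0 i j)
    have h2 := Γ.mul_mem (hd i) hg
    have h3 := Γ.degree_unique (hne 0 j (Nat.zero_le j)) (hd j) (h1 ▸ h2)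
    rw [h3, inv_mul_cancel_left]
    exact hg
  -- The operator r sends every c_j to c_0. From r f_j = e_0j, of degree d_j, it follows that
  -- r_{d_j} f_j = e_0j ≠ 0, so each d_j is among the finitely many degrees of r.
  have hfin : (Set.range d).Finite := by
    have hr : c.constr F (fun _ => c 0) ∈ upperTriangular c := fun j => by
      rw [Module.Basis.constr_basis]
      exact Submodule.subset_span ⟨0, Nat.zero_le j, rfl⟩
    let r : upperTriangular c := ⟨_, hr⟩
    obtain ⟨s, hs, -⟩ := Γ.exists_sum_proj r
    refine s.finite_toSet.subset ?_
    rintro _ ⟨j, rfl⟩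
    by_contra hj
    have h1 : r * f j = e 0 j (Nat.zero_le j) := by
      refine Subtype.ext (c.ext fun k => ?_)
      change c.constr F (fun _ => c 0) ((f j).1 (c k)) = matrixUnit c 0 j (c k)
      rw [hfc, matrixUnit_apply, matrixUnit_apply, map_smul, Module.Basis.constr_basis]
    refine hne 0 j (Nat.zero_le j) ?_
    rw [← Γ.proj_of_mem (hd' 0 j (Nat.zero_le j)), ← h1, Γ.proj_mul_one (hf j)]
    have h2 : (d 0)⁻¹ * d j = d j := by
      have h4 : d 0 = 1 := Γ.degree_unique (hne 0 0 le_rfl) (hd 0)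
        (by rw [← inv_mul_cancel (d 0)]; exact hd' 0 0 le_rfl)
      rw [h4, inv_one, one_mul]
    rw [h2, hs _ hj, zero_mul]
  have hcorner : ∀ (t : upperTriangular c) i j v,
      (f i * t * f j).1 v = (c.repr v j * c.repr (t.1 (c j)) i) • c i := by
    intro t i j v
    change (f i).1 (t.1 ((f j).1 v)) = _
    rw [hfc, hfc, matrixUnit_apply c j, map_smul, map_smul, matrixUnit_apply, smul_smul]
  -- Membership in a component can be tested entrywise even for infinitely many entries: cutting by
  -- f_i and f_j commutes with the projections.
  have hmem : ∀ (t : upperTriangular c) g,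
      (∀ i j, c.repr (t.1 (c j)) i ≠ 0 → (d i)⁻¹ * d j = g) → t ∈ Γ.component g := by
    intro t g ht
    refine Γ.mem_component_of_proj_eq_zero fun k hk =>
      Subtype.ext (c.ext fun j => c.repr.injective (Finsupp.ext fun i => ?_))
    have h1 : f i * Γ.proj k t * f j = 0 := by
      rw [← Γ.proj_one_mul (hf i), ← Γ.proj_mul_one (hf j)]
      by_cases h0 : c.repr (t.1 (c j)) i = 0
      · have : f i * t * f j = 0 := Subtype.ext (LinearMap.ext fun v => by
          rw [hcorner, h0, mul_zero, zero_smul]; rfl)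
        rw [this, map_zero]
      · have hij : i ≤ j := by
          by_contra hij
          exact h0 ((mem_upperTriangular_iff c).1 t.2 i j (not_le.1 hij))
        have : f i * t * f j = c.repr (t.1 (c j)) i • e i j hij :=
          Subtype.ext (LinearMap.ext fun v => by
            rw [hcorner, mul_comm, ← smul_smul]
            exact congrArg _ (matrixUnit_apply c i j v).symm)
        rw [this, map_smul, Γ.proj_of_mem_of_ne _ (hd' i j hij), smul_zero]
        rw [ht i j h0]
        exact hk.symm
    have h2 := hcorner (Γ.proj k t) i j (c j)
    rw [h1] at h2
    have h3 := congrArg (fun v => c.repr v i) h2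
    simpa using h3.symm
  obtain ⟨l, m, n, hl, hld, hmn, hdmn, hlmn⟩ := exists_finer_labelling hfin
  -- `ULift` only places the group in the prescribed universe.
  let κ : ℕ → ULift.{u₁} (Multiplicative (ℕ → ℤ)) := fun i => ULift.up (deltaMap (l i))
  have hκ : (Set.range κ).Finite := by
    refine (hl.image fun k => ULift.up (deltaMap k)).subset ?_
    rintro _ ⟨i, rfl⟩
    exact ⟨l i, ⟨i, rfl⟩, rfl⟩
  have hinj : ∀ i j i' j', (κ i)⁻¹ * κ j = (κ i')⁻¹ * κ j' →
      (l i = l j ∧ l i' = l j') ∨ (l i = l i' ∧ l j = l j') := fun i j i' j' h =>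
    inv_deltaMap_mul_deltaMap_eq (congrArg ULift.down h)
  refine ⟨_, inferInstance, triangularGrading c κ hκ, isFinite_triangularGrading c hκ, ?_, ?_⟩
  · intro h
    by_cases hh : ∃ i j, (κ i)⁻¹ * κ j = h
    · obtain ⟨i, j, rfl⟩ := hh
      refine ⟨(d i)⁻¹ * d j, fun t ht => hmem t _ fun i' j' h0 => ?_⟩
      rcases hinj _ _ _ _ (ht i' j' h0) with ⟨h1, h2⟩ | ⟨h1, h2⟩
      · rw [hld _ _ h1, hld _ _ h2, inv_mul_cancel, inv_mul_cancel]
      · rw [hld _ _ h1, hld _ _ h2]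
    · exact ⟨1, fun t ht => hmem t _ fun i j h0 => absurd ⟨i, j, ht i j h0⟩ hh⟩
  · intro heq
    -- The degree 1 component of Γ contains both e_mm and e_mn, as d_m = d_n, whereas the new
    -- grading separates them.
    have h1 : Γ.component 1 ∈ (triangularGrading c κ hκ).components := by
      rw [heq]
      refine ⟨1, GroupGrading.mem_support_of_mem (hne 0 0 le_rfl) ?_, rfl⟩
      simpa using hd' 0 0 le_rfl
    obtain ⟨h, -, hh⟩ := h1
    have hentry : ∀ i j (hij : i ≤ j), c.repr ((e i j hij).1 (c j)) i ≠ 0 := fun i j hij => by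
      change c.repr (matrixUnit c i j (c j)) i ≠ 0
      rw [matrixUnit_apply_self]
      simp
    have h2 : e m m le_rfl ∈ (triangularGrading c κ hκ).component h := by
      rw [hh]
      simpa using hd' m m le_rfl
    have h3 : e m n hmn.le ∈ (triangularGrading c κ hκ).component h := by
      rw [hh]
      simpa [hdmn] using hd' m n hmn.le
    rcases hinj _ _ _ _ ((h2 m m (hentry m m le_rfl)).trans (h3 m n (hentry m n hmn.le)).symm) with
      ⟨-, h4⟩ | ⟨-, h4⟩ <;> exact hlmn h4

open TriangularEmbedding in
/-- Every group grading on the algebra of all triangular operators has a proper refinement that is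
a finite group grading. -/
theorem exists_finite_properRefinement.{u₁} (b : Module.Basis ℕ F V) {G : Type*} [Group G]
    (Γ : GroupGrading F G (upperTriangular b)) :
    ∃ (H : Type u₁) (_ : Group H) (Γ' : GroupGrading F H (upperTriangular b)),
      Γ'.IsFinite ∧ Γ'.IsProperRefinementOf Γ := by
  -- The degree 1 part of the unit is already a left unit, since 1_1 x_g is the degree g part of 1
  -- x_g.
  have hone : (1 : upperTriangular b) ∈ Γ.component 1 := by
    have h1 : ∀ x, Γ.proj 1 1 * x = x := fun x => by
      obtain ⟨s, -, hs⟩ := Γ.exists_sum_proj x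
      rw [← hs, Finset.mul_sum]
      refine Finset.sum_congr rfl fun g _ => ?_
      rw [← Γ.proj_mul_right (Γ.proj_mem g x), one_mul, one_mul, Γ.proj_of_mem (Γ.proj_mem g x)]
    rw [← h1 1, mul_one]
    exact Γ.proj_mem 1 1
  obtain ⟨f, hf, -⟩ := IdempotentFamily.exists_univ (ofUpperTriangular b) Γ
    (P := fun _ _ => True) (fun D f m h => by
      obtain ⟨D', g, h1, h2, h3, -, -, h4⟩ := h.exists_extension hone (one_mul 1)
        (fun i _ => one_mul (f i)) (fun i _ => mul_one (f i)) (m + 1)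
      refine ⟨D', g, h1, h2, h3, h4 m (Nat.lt_succ_self m) ?_, trivial⟩
      rw [diag_apply]
      change b.repr (b m) m ≠ 0
      simp)
  obtain ⟨c, hc, hcf⟩ := hf.exists_basis
  exact exists_finite_properRefinement_of_diagonal c (upperTriangular_eq_of_span_eq hc).symm Γ
    (fun i => hf.mem i trivial) hcf

end TriangularGrading

/-! ### The direct limit algebra: local units, adapted bases and fine gradings -/

section DirectLimit

variable {F : Type*} [Field F] {V : Type*} [AddCommGroup V] [Module F V]

open Polynomial in
/-- Modulo a polynomial with the roots `0` and `1` there is an idempotent polynomial with the value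
`0` at `0` and the value `1` at `1`. -/
theorem exists_idempotent_polynomial {Q : F[X]} (hQ : Q ≠ 0) (h0 : X ∣ Q) (h1 : Q.IsRoot 1) :
    ∃ r : F[X], Q ∣ (X * r) * (X * r) - X * r ∧ r.eval 1 = 1 := by
  obtain ⟨S, hS, hS1⟩ := exists_eq_pow_rootMultiplicity_mul_and_not_dvd Q hQ 1
  have ha : rootMultiplicity 1 Q ≠ 0 := ((rootMultiplicity_pos hQ).2 h1).ne'
  set a := rootMultiplicity 1 Q
  have hcop : IsCoprime ((X - C (1 : F)) ^ a) S :=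
    (((irreducible_X_sub_C (1 : F)).coprime_iff_not_dvd).2 hS1).pow_left
  have hX : IsCoprime (X : F[X]) ((X - C (1 : F)) ^ a) := by
    refine IsCoprime.pow_right ?_
    simpa using isCoprime_X_sub_C_of_isUnit_sub (a := (0 : F)) (b := 1) (by simp)
  -- With Q = (X - 1)^a S and α(X - 1)^a + βS = 1, the polynomial βS is 0 modulo S and 1 modulo (X -
  -- 1)^a, hence idempotent modulo Q. Dividing S by X exhibits it as X r.
  obtain ⟨T, hT⟩ : X ∣ S := hX.dvd_of_dvd_mul_left (hS ▸ h0)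
  obtain ⟨α, β, hαβ⟩ := hcop
  refine ⟨β * T, ⟨-(α * β), ?_⟩, ?_⟩
  · have h2 : β * S = 1 - α * (X - C (1 : F)) ^ a := by rw [← hαβ]; ring
    have h3 : X * (β * T) = β * S := by rw [hT]; ring
    rw [h3, hS]
    linear_combination (β * S) * h2
  · have h2 := congrArg (eval 1) hαβ
    rw [hT] at h2
    simpa [ha, zero_pow] using h2

-- Cayley–Hamilton for triangular operators: the factor with index n removes the n-th coordinate of
-- a vector supported up to n, and the remaining factors handle what is left.
open Polynomial in
theorem aeval_prod_apply_eq_zero (b : Module.Basis ℕ F V) {t : Module.End F V}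
    (ht : ∀ i j, j < i → b.repr (t (b j)) i = 0) (n : ℕ) {v : V}
    (hv : ∀ k, n ≤ k → b.repr v k = 0) :
    aeval t (∏ i ∈ Finset.range n, (X - C (b.repr (t (b i)) i))) v = 0 := by
  induction n generalizing v with
  | zero =>
    have : v = 0 := b.repr.injective (Finsupp.ext fun k => by simpa using hv k (Nat.zero_le k))
    rw [this, map_zero]
  | succ n ih =>
    rw [Finset.prod_range_succ, map_mul, Module.End.mul_apply]
    refine ih fun k hk => ?_
    have h1 : aeval t (X - C (b.repr (t (b n)) n)) v = t v - b.repr (t (b n)) n • v := by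
      simp [Module.algebraMap_end_apply]
    rw [h1, map_sub, Finsupp.sub_apply, map_smul, Finsupp.smul_apply]
    rcases eq_or_lt_of_le hk with rfl | hk
    · rw [repr_apply_top b ht hv, smul_eq_mul, mul_comm, sub_self]
    · rw [repr_apply_above b ht hv hk, hv k hk, smul_zero, sub_zero]

/-- The sum of the first `N` diagonal matrix units. -/
noncomputable def limTrunc (b : Module.Basis ℕ F V) (N : ℕ) : upperTriangularLim b :=
  ⟨∑ i ∈ Finset.range N, matrixUnit b i i,
    sum_mem fun _ _ => matrixUnit_mem_upperTriangularLim b le_rfl⟩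

theorem exists_limTrunc (b : Module.Basis ℕ F V) (x : upperTriangularLim b) :
    ∃ N, ∀ n, N ≤ n → limTrunc b n * x = x ∧ x * limTrunc b n = x := by
  obtain ⟨hx, N, hN⟩ := (mem_upperTriangularLim_iff b).1 x.2
  refine ⟨N, fun n hn => ⟨Subtype.ext (b.ext fun j => ?_), Subtype.ext (b.ext fun j => ?_)⟩⟩
  · change (∑ i ∈ Finset.range n, matrixUnit b i i) (x.1 (b j)) = x.1 (b j)
    rcases lt_or_ge j N with hj | hj
    · have : Submodule.span F (b '' Set.Iic j) ≤
          LinearMap.eqLocus (∑ i ∈ Finset.range n, matrixUnit b i i) LinearMap.id := by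
        rw [Submodule.span_le]
        rintro _ ⟨i, hi, rfl⟩
        change (∑ i ∈ Finset.range n, matrixUnit b i i) (b i) = b i
        rw [sum_matrixUnit_apply, if_pos ((lt_of_le_of_lt hi hj).trans_le hn)]
      exact this (hx j)
    · rw [hN j hj, map_zero]
  · change x.1 ((∑ i ∈ Finset.range n, matrixUnit b i i) (b j)) = x.1 (b j)
    rw [sum_matrixUnit_apply]
    split_ifs with hj
    · rfl
    · rw [map_zero, hN j (hn.trans (not_lt.1 hj))]

variable {G : Type*} [Group G]

/-- A large truncation fixes every homogeneous component x_g on both sides. Comparing components of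
degree g shows that its degree 1 part does so too. -/
theorem exists_homogeneous_local_unit (b : Module.Basis ℕ F V)
    (Γ : GroupGrading F G (upperTriangularLim b)) (x : upperTriangularLim b) :
    ∃ u ∈ Γ.component 1, u * x = x ∧ x * u = x := by
  obtain ⟨s, -, hs⟩ := Γ.exists_sum_proj x
  choose N hN using fun g => exists_limTrunc b (Γ.proj g x)
  refine ⟨Γ.proj 1 (limTrunc b (s.sup N)), Γ.proj_mem _ _, ?_, ?_⟩
  · conv_rhs => rw [← hs]
    conv_lhs => rw [← hs]
    rw [Finset.mul_sum]
    refine Finset.sum_congr rfl fun g hg => ?_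
    rw [← Γ.proj_mul_right (Γ.proj_mem g x), one_mul, (hN g _ (Finset.le_sup hg)).1,
      Γ.proj_of_mem (Γ.proj_mem g x)]
  · conv_rhs => rw [← hs]
    conv_lhs => rw [← hs]
    rw [Finset.sum_mul]
    refine Finset.sum_congr rfl fun g hg => ?_
    rw [← Γ.proj_mul_left (Γ.proj_mem g x), mul_one, (hN g _ (Finset.le_sup hg)).2,
      Γ.proj_of_mem (Γ.proj_mem g x)]

-- The algebra has no unit, so only polynomials without constant term can be evaluated inside it. As
-- u acts on x as the identity, a polynomial in u acts on x by its value at 1.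
open Polynomial in
theorem exists_aeval_X_mul (b : Module.Basis ℕ F V)
    (Γ : GroupGrading F G (upperTriangularLim b)) {u x : upperTriangularLim b}
    (hu : u ∈ Γ.component 1) (hux : u * x = x) (hxu : x * u = x) (r : F[X]) :
    ∃ y ∈ Γ.component 1, (y : Module.End F V) = aeval (u : Module.End F V) (X * r) ∧
      y * x = r.eval 1 • x ∧ x * y = r.eval 1 • x := by
  induction r using Polynomial.induction_on with
  | C a =>
    refine ⟨a • u, Submodule.smul_mem _ _ hu, ?_, ?_, ?_⟩
    · change a • (u : Module.End F V) = _
      rw [map_mul, aeval_X, aeval_C, ← Algebra.commutes, ← Algebra.smul_def]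
    · rw [smul_mul_assoc, hux, eval_C]
    · rw [mul_smul_comm, hxu, eval_C]
  | add p q hp hq =>
    obtain ⟨y, hy, h1, h2, h3⟩ := hp
    obtain ⟨z, hz, h4, h5, h6⟩ := hq
    refine ⟨y + z, Submodule.add_mem _ hy hz, ?_, ?_, ?_⟩
    · change (y : Module.End F V) + (z : Module.End F V) = _
      rw [h1, h4, mul_add, map_add]
    · rw [add_mul, h2, h5, eval_add, add_smul]
    · rw [mul_add, h3, h6, eval_add, add_smul]
  | monomial n a hn =>
    obtain ⟨y, hy, h1, h2, h3⟩ := hn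
    refine ⟨y * u, by simpa using Γ.mul_mem hy hu, ?_, ?_, ?_⟩
    · change (y : Module.End F V) * (u : Module.End F V) = _
      have h4 : X * (C a * X ^ (n + 1)) = X * (C a * X ^ n) * X := by ring
      rw [h1, h4, map_mul _ _ X, aeval_X]
    · rw [mul_assoc, hux, h2]
      simp
    · rw [← mul_assoc, h3, smul_mul_assoc, hxu]
      simp

open Polynomial in
/-- Every element has a homogeneous idempotent of degree `1` as a two-sided local unit. -/
theorem exists_homogeneous_idempotent_local_unit (b : Module.Basis ℕ F V)
    (Γ : GroupGrading F G (upperTriangularLim b)) (x : upperTriangularLim b) :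
    ∃ E ∈ Γ.component 1, E * E = E ∧ E * x = x ∧ x * E = x := by
  obtain ⟨u, hu, hux, hxu⟩ := exists_homogeneous_local_unit b Γ x
  obtain ⟨hut, N, hN⟩ := (mem_upperTriangularLim_iff b).1 u.2
  rw [mem_upperTriangular_iff] at hut
  let R : F[X] := ∏ i ∈ Finset.range N, (X - C (b.repr (u.1 (b i)) i))
  -- R kills the span of the first N basis vectors and u maps into it, so R X already annihilates u.
  -- The factor X - 1 only guarantees the root 1.
  have hQ0 : (X - C 1) * (R * X) ≠ 0 :=
    ((monic_X_sub_C 1).mul ((monic_prod_of_monic _ _ fun i _ => monic_X_sub_C _).mul monic_X)).ne_zero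
  obtain ⟨r, hr, hr1⟩ := exists_idempotent_polynomial hQ0
    (dvd_mul_of_dvd_right (dvd_mul_left X R) _) (by simp)
  have hQu : aeval (u : Module.End F V) ((X - C 1) * (R * X)) = 0 := by
    refine b.ext fun j => ?_
    rw [map_mul, map_mul, aeval_X, Module.End.mul_apply, Module.End.mul_apply]
    have : aeval (u : Module.End F V) R (u.1 (b j)) = 0 := by
      refine aeval_prod_apply_eq_zero b hut N fun k hk => ?_
      rcases lt_or_ge j N with hj | hj
      · exact hut k j (hj.trans_le hk)
      · rw [hN j hj, map_zero, Finsupp.zero_apply]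
    rw [this, map_zero, LinearMap.zero_apply]
  obtain ⟨E, hE, hEu, hEx, hxE⟩ := exists_aeval_X_mul b Γ hu hux hxu r
  refine ⟨E, hE, Subtype.ext ?_, by rw [hEx, hr1, one_smul], by rw [hxE, hr1, one_smul]⟩
  change (E : Module.End F V) * (E : Module.End F V) = E
  rw [hEu, ← map_mul, ← sub_eq_zero, ← map_sub]
  obtain ⟨q, hq⟩ := hr
  rw [hq, map_mul, hQu, zero_mul]

open TriangularEmbedding in
/-- For every grading on the direct limit there is a basis that defines the same algebra and whose
diagonal matrix units are homogeneous of degree `1`. -/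
theorem exists_basis_homogeneous (b : Module.Basis ℕ F V)
    (Γ : GroupGrading F G (upperTriangularLim b)) :
    ∃ (c : Module.Basis ℕ F V) (f : ℕ → upperTriangularLim b),
      upperTriangularLim c = upperTriangularLim b ∧ (∀ i, f i ∈ Γ.component 1) ∧
        ∀ i, (f i : Module.End F V) = matrixUnit c i i := by
  -- The property P makes finite sums of the f_i local units for the truncations. Without it, c
  -- would span the same flag but its matrix units might span a smaller algebra.
  obtain ⟨f, hf, hD⟩ := IdempotentFamily.exists_univ (ofUpperTriangularLim b) Γ
    (P := fun m y => y * limTrunc b m = limTrunc b m ∧ limTrunc b m * y = limTrunc b m)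
    (fun D f m h => by
      obtain ⟨N₁, h₁⟩ := exists_limTrunc b (∑ i ∈ D, f i)
      obtain ⟨N₂, h₂⟩ := exists_limTrunc b (limTrunc b m)
      obtain ⟨N₃, h₃⟩ := exists_limTrunc b (limUnit b ⟨(m, m), le_rfl⟩)
      obtain ⟨E, hE, hEE, hET, hTE⟩ := exists_homogeneous_idempotent_local_unit b Γ
        (limTrunc b (max N₁ (max N₂ N₃)))
      have hl : ∀ {z}, limTrunc b (max N₁ (max N₂ N₃)) * z = z → E * z = z := fun {z} hz => by
        rw [← hz, ← mul_assoc, hET]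
      have hr : ∀ {z}, z * limTrunc b (max N₁ (max N₂ N₃)) = z → z * E = z := fun {z} hz => by
        rw [← hz, mul_assoc, hTE]
      have h₁' := h₁ _ (le_max_left N₁ (max N₂ N₃))
      have h₂' := h₂ _ ((le_max_left N₂ N₃).trans (le_max_right N₁ _))
      have h₃' := h₃ _ ((le_max_right N₂ N₃).trans (le_max_right N₁ _))
      have hEf : ∀ i ∈ D, E * f i = f i := fun i hi => by
        rw [← h.sum_mul hi, ← mul_assoc, hl h₁'.1]
      have hfE : ∀ i ∈ D, f i * E = f i := fun i hi => by
        rw [← h.mul_sum hi, mul_assoc, hr h₁'.2]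
      obtain ⟨-, N, hN⟩ := (mem_upperTriangularLim_iff b).1 E.2
      obtain ⟨D', g, h1, h2, h3, h4, h5, h6⟩ := h.exists_extension hE hEE hEf hfE N
      have h7 : ∀ k, (ofUpperTriangularLim b).diag k E ≠ 0 → k ∈ D' := fun k hk => by
        refine h6 k ?_ hk
        by_contra hkN
        refine hk ?_
        change b.repr (E.1 (b k)) k = 0
        rw [hN k (not_lt.1 hkN), map_zero, Finsupp.zero_apply]
      -- E has finitely many nonzero diagonal entries and D' covers them all, so the remaining
      -- idempotent has zero diagonal and vanishes.
      have h8 : E = ∑ i ∈ D', g i := by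
        rw [← sub_eq_zero]
        refine eq_zero_of_diag_eq_zero (ofUpperTriangularLim b) (h3.sub_mul_sub hEE h4 h5)
          fun k => ?_
        rw [h3.diag_sub h4]
        split_ifs with hk
        · rfl
        · by_contra hk0
          exact hk (h7 k hk0)
      refine ⟨D', g, h1, h2, h3, h7 m fun h0 => ?_, ?_⟩
      · have h9 := (ofUpperTriangularLim b).diag_mul m E (limUnit b ⟨(m, m), le_rfl⟩)
        rw [hl h₃'.1, h0, zero_mul] at h9
        change b.repr (matrixUnit b m m (b m)) m = 0 at h9
        simp [matrixUnit_apply_self] at h9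
      · rw [← h8]
        exact ⟨hl h₂'.1, hr h₂'.2⟩)
  obtain ⟨c, hc, hcf⟩ := hf.exists_basis
  have hfc : ∀ i, (f i : Module.End F V) = matrixUnit c i i := hcf
  have hUT := upperTriangular_eq_of_span_eq hc
  refine ⟨c, f, le_antisymm (fun t ht => ?_) (fun t ht => ?_), fun i => hf.mem i trivial, hfc⟩
  · refine upperTriangularLim_induction (p := (upperTriangularLim b).toSubmodule)
      (fun i j hij => ?_) ht
    change matrixUnit c i j ∈ upperTriangularLim b
    refine (mem_upperTriangularLim_iff b).2
      ⟨hUT ▸ matrixUnit_mem_upperTriangular c hij, ?_⟩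
    obtain ⟨-, N, hN⟩ := (mem_upperTriangularLim_iff b).1 (f j).2
    refine ⟨N, fun k hk => ?_⟩
    -- The matrix unit of c factors through f_j, which lies in the algebra and so kills almost all
    -- b_k.
    rw [← matrixUnit_mul_same c i j j, ← hfc, Module.End.mul_apply, hN k hk, map_zero]
  · obtain ⟨m, hm⟩ := exists_limTrunc b ⟨t, ht⟩
    obtain ⟨D, hD₁, hD₂⟩ := hD m
    obtain ⟨hm₁, hm₂⟩ := hm m le_rfl
    have h1 : (∑ i ∈ D, f i) * ⟨t, ht⟩ * (∑ i ∈ D, f i) = ⟨t, ht⟩ := by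
      rw [← hm₁, ← mul_assoc, hD₁, hm₁, ← hm₂, mul_assoc, hD₂, hm₂]
    have h2 : t = ∑ k ∈ D, ∑ l ∈ D, matrixUnit c k k * t * matrixUnit c l l := by
      have := congrArg Subtype.val h1
      rw [Finset.sum_mul, Finset.sum_mul] at this
      simp_rw [Finset.mul_sum] at this
      conv_lhs => rw [← this]
      rw [AddSubmonoidClass.coe_finsetSum]
      refine Finset.sum_congr rfl fun k _ => ?_
      rw [AddSubmonoidClass.coe_finsetSum]
      refine Finset.sum_congr rfl fun l _ => ?_
      rw [← hfc, ← hfc]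
      rfl
    rw [h2]
    refine sum_mem fun k _ => sum_mem fun l _ => ?_
    have h3 : matrixUnit c k k * t * matrixUnit c l l =
        c.repr (t (c l)) k • matrixUnit c k l := by
      refine LinearMap.ext fun v => ?_
      rw [Module.End.mul_apply, Module.End.mul_apply, matrixUnit_apply c l, map_smul, map_smul,
        LinearMap.smul_apply, matrixUnit_apply, matrixUnit_apply, smul_comm]
    rw [h3]
    rcases le_or_gt k l with hkl | hkl
    · exact SMulMemClass.smul_mem _ (matrixUnit_mem_upperTriangularLim c hkl)
    · have htc : t ∈ upperTriangular c := hUT ▸ upperTriangularLim_le_upperTriangular b ht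
      rw [(mem_upperTriangular_iff c).1 htc k l hkl, zero_smul]
      exact zero_mem _

/-- If two bases define the same direct limit algebra, then the change of basis defines an
automorphism of this algebra. -/
theorem exists_automorphism {ι : Type*} [Preorder ι] {b c : Module.Basis ι F V}
    (h : upperTriangularLim c = upperTriangularLim b) :
    ∃ φ : upperTriangularLim b ≃ₗ[F] upperTriangularLim b, (∀ x y, φ (x * y) = φ x * φ y) ∧
      ∀ p, (φ (limUnit b p) : Module.End F V) = matrixUnit c p.1.1 p.1.2 := by
  let e : V ≃ₗ[F] V := b.equiv c (Equiv.refl ι)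
  have he : ∀ i j, e.conj (matrixUnit b i j) = matrixUnit c i j := fun i j => by
    refine c.ext fun k => ?_
    have h1 : e.symm (c k) = b k := by
      rw [LinearEquiv.symm_apply_eq]
      simp [e]
    rw [LinearEquiv.conj_apply_apply, h1, matrixUnit_apply, matrixUnit_apply, map_smul]
    simp [e]
  have hmap : (upperTriangularLim b).toSubmodule.map (e.conj : Module.End F V →ₗ[F] _) =
      (upperTriangularLim b).toSubmodule := by
    conv_rhs => rw [← h]
    change Submodule.map _ (Submodule.span F _) = Submodule.span F _
    rw [Submodule.map_span]
    congr 1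
    ext t
    constructor
    · rintro ⟨_, ⟨i, j, hij, rfl⟩, rfl⟩
      exact ⟨i, j, hij, he i j⟩
    · rintro ⟨i, j, hij, rfl⟩
      exact ⟨_, ⟨i, j, hij, rfl⟩, he i j⟩
  refine ⟨LinearEquiv.ofSubmodules e.conj _ _ hmap, fun x y => Subtype.ext ?_, fun p => he _ _⟩
  change e.conj (x.1 * y.1) = e.conj x.1 * e.conj y.1
  refine LinearMap.ext fun v => ?_
  simp [LinearEquiv.conj_apply_apply]

-- In an adapted basis all matrix units are homogeneous, and a component of Γ_U carries either one
-- off-diagonal unit or the whole diagonal. Hence the copy of Γ_U attached to that basis refines Γ,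
-- and fineness makes the two coincide.
open TriangularEmbedding in
theorem equivalent_elementaryGrading_of_isFine.{u₁} (b : Module.Basis ℕ F V)
    (Γ : GroupGrading F G (upperTriangularLim b)) (hΓ : GroupGrading.IsFine.{u₁} Γ) :
    Γ.Equivalent (elementaryGrading b deltaMap) := by
  obtain ⟨c, f, hcb, hf, hfc⟩ := exists_basis_homogeneous b Γ
  obtain ⟨φ, hφ, hφc⟩ := exists_automorphism hcb
  have hUT : ∀ x : upperTriangularLim b, x.1 ∈ upperTriangularLim c := fun x => hcb.ge x.2
  let ρ : TriangularEmbedding c (upperTriangularLim b) :=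
    { toLin := (upperTriangularLim b).toSubmodule.subtype
      map_mul := fun _ _ => rfl
      injective := Subtype.val_injective
      triangular := fun x => (mem_upperTriangular_iff c).1
        (upperTriangularLim_le_upperTriangular c (hUT x))
      exists_unit := fun i j hij => ⟨⟨_, hcb.le (matrixUnit_mem_upperTriangularLim c hij)⟩, rfl⟩ }
  let Γ' := (elementaryGrading b deltaMap).transport φ hφ
    (MulEquiv.ulift : ULift.{u₁} (Multiplicative (ℕ → ℤ)) ≃* _)
  have hr : Γ'.IsRefinementOf Γ := by
    rintro ⟨h⟩
    -- it suffices to treat the generators of a component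
    suffices H : ∃ g, ∀ p : {p : ℕ × ℕ // p.1 ≤ p.2}, (deltaMap p.1.1)⁻¹ * deltaMap p.1.2 = h →
        φ (limUnit b p) ∈ Γ.component g by
      obtain ⟨g, hg⟩ := H
      refine ⟨g, ?_⟩
      change Submodule.map _ (Submodule.span F _) ≤ _
      rw [Submodule.map_span, Submodule.span_le]
      rintro _ ⟨_, ⟨p, hp, rfl⟩, rfl⟩
      exact hg p hp
    by_cases hh : ∃ p : {p : ℕ × ℕ // p.1 ≤ p.2}, (deltaMap p.1.1)⁻¹ * deltaMap p.1.2 = h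
    · obtain ⟨p, rfl⟩ := hh
      by_cases hp : p.1.1 = p.1.2
      · refine ⟨1, fun q hq => ?_⟩
        have hq' : q.1.1 = q.1.2 := by
          rcases inv_deltaMap_mul_deltaMap_eq hq with ⟨h1, -⟩ | ⟨h1, h2⟩
          · exact h1
          · rw [h1, h2, hp]
        have : φ (limUnit b q) = f q.1.1 := Subtype.ext (by rw [hφc, hfc, ← hq'])
        rw [this]
        exact hf _
      · obtain ⟨g, hg⟩ := ρ.exists_degree Γ (hf p.1.1) (hf p.1.2) (hfc _) (hfc _) (hφc p)
        refine ⟨g, fun q hq => ?_⟩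
        have : q = p := by
          rcases inv_deltaMap_mul_deltaMap_eq hq with ⟨-, h1⟩ | ⟨h1, h2⟩
          · exact absurd h1 hp
          · exact Subtype.ext (Prod.ext h1 h2)
        rw [this]
        exact hg
    · exact ⟨1, fun p hp => absurd ⟨p, hp⟩ hh⟩
  have heq : Γ'.components = Γ.components := by
    by_contra hne
    exact hΓ _ Γ' ⟨hr, hne⟩
  refine ⟨φ.symm, fun x y => ?_, ?_⟩
  · rw [LinearEquiv.symm_apply_eq, hφ, LinearEquiv.apply_symm_apply, LinearEquiv.apply_symm_apply]
  · rw [← heq, GroupGrading.components_transport, Set.image_image]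
    conv_rhs => rw [← Set.image_id (elementaryGrading b deltaMap).components]
    refine Set.image_congr fun S _ => ?_
    rw [← Submodule.map_comp]
    simp

theorem isFine_elementaryGrading_deltaMap.{u₁} (b : Module.Basis ℕ F V) :
    GroupGrading.IsFine.{u₁} (elementaryGrading b deltaMap) := by
  rintro H _ Γ' ⟨hr, hne⟩
  refine hne (GroupGrading.components_eq_of_isRefinementOf hr ?_)
  have hlim : ∀ p, limUnit b p ≠ 0 := (linearIndependent_limUnit b).ne_zero
  have hsing : ∀ p : {p : ℕ × ℕ // p.1 ≤ p.2}, p.1.1 ≠ p.1.2 →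
      (elementaryGrading b deltaMap).component ((deltaMap p.1.1)⁻¹ * deltaMap p.1.2) =
        Submodule.span F {limUnit b p} := by
    intro p hp
    rw [← Set.image_singleton]
    change Submodule.span F (limUnit b '' _) = _
    congr 2
    ext q
    constructor
    · intro hq
      rcases inv_deltaMap_mul_deltaMap_eq hq with ⟨-, h1⟩ | ⟨h1, h2⟩
      · exact absurd h1 hp
      · exact Subtype.ext (Prod.ext h1 h2)
    · rintro rfl
      rfl
  -- The components of an element of a line that is a graded subspace are multiples of it.
  have hoff : ∀ p : {p : ℕ × ℕ // p.1 ≤ p.2}, p.1.1 ≠ p.1.2 →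
      ∃ h, limUnit b p ∈ Γ'.component h := by
    intro p hp
    obtain ⟨h, hh⟩ := Γ'.exists_proj_ne_zero (hlim p)
    have h1 := hr.proj_mem (g := (deltaMap p.1.1)⁻¹ * deltaMap p.1.2) (x := limUnit b p)
      (Submodule.subset_span ⟨p, rfl, rfl⟩) h
    rw [hsing p hp, Submodule.mem_span_singleton] at h1
    obtain ⟨a, ha⟩ := h1
    have ha0 : a ≠ 0 := by
      rintro rfl
      exact hh (by rw [← ha, zero_smul])
    refine ⟨h, ?_⟩
    rw [← inv_smul_smul₀ ha0 (limUnit b p), ha]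
    exact Submodule.smul_mem _ _ (Γ'.proj_mem h _)
  have hdiag : ∀ y ∈ (elementaryGrading b deltaMap).component 1, ∀ i, ∃ a : F,
      y.1 (b i) = a • b i := by
    intro y hy i
    refine Submodule.span_induction (p := fun y _ => ∃ a : F, y.1 (b i) = a • b i)
      ?_ ?_ ?_ ?_ hy
    · rintro _ ⟨p, hp, rfl⟩
      have hp' : p.1.1 = p.1.2 := by
        rcases inv_deltaMap_mul_deltaMap_eq (k := 0) (l := 0) (hp.trans (by simp)) with
          ⟨h1, -⟩ | ⟨h1, h2⟩
        · exact h1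
        · rw [h1, h2]
      change ∃ a : F, matrixUnit b p.1.1 p.1.2 (b i) = a • b i
      rw [hp']
      by_cases hi : i = p.1.2
      · exact ⟨1, by rw [← hi, matrixUnit_apply_self, one_smul]⟩
      · exact ⟨0, by rw [matrixUnit_apply_of_ne b _ hi, zero_smul]⟩
    · exact ⟨0, by rw [zero_smul]; rfl⟩
    · rintro x y _ _ ⟨a, ha⟩ ⟨a', ha'⟩
      refine ⟨a + a', ?_⟩
      change x.1 (b i) + y.1 (b i) = _
      rw [ha, ha', add_smul]
    · rintro a x _ ⟨a', ha'⟩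
      refine ⟨a * a', ?_⟩
      change a • x.1 (b i) = _
      rw [ha', smul_smul]
  intro g
  by_cases hg : g = 1
  · subst hg
    refine ⟨1, fun x hx => Γ'.mem_component_of_proj_eq_zero fun h hh => ?_⟩
    refine Subtype.ext (b.ext fun i => ?_)
    obtain ⟨a, ha⟩ := hdiag _ (hr.proj_mem hx h) i
    rw [ha]
    by_contra h0
    have ha0 : a ≠ 0 := by
      rintro rfl
      exact h0 (by rw [zero_smul]; rfl)
    -- A nonzero entry at i multiplies e_{i,i+1} by a nonzero scalar. If that unit has degree k,
    -- then hk = k, so h = 1.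
    let p : {p : ℕ × ℕ // p.1 ≤ p.2} := ⟨(i, i + 1), Nat.le_succ i⟩
    obtain ⟨k, hk⟩ := hoff p (Nat.succ_ne_self i).symm
    have h1 : Γ'.proj h x * limUnit b p = a • limUnit b p := by
      refine Subtype.ext (LinearMap.ext fun v => ?_)
      change (Γ'.proj h x).1 (matrixUnit b i (i + 1) v) = a • matrixUnit b i (i + 1) v
      rw [matrixUnit_apply, map_smul, ha, smul_comm]
    have h2 := Γ'.degree_unique (smul_ne_zero ha0 (hlim p)) (Submodule.smul_mem _ a hk)
      (h1 ▸ Γ'.mul_mem (Γ'.proj_mem h x) hk)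
    exact hh (mul_eq_right.1 h2.symm)
  · by_cases hp : ∃ p : {p : ℕ × ℕ // p.1 ≤ p.2}, (deltaMap p.1.1)⁻¹ * deltaMap p.1.2 = g
    · obtain ⟨p, rfl⟩ := hp
      have hpne : p.1.1 ≠ p.1.2 := fun h => hg (by rw [h, inv_mul_cancel])
      obtain ⟨h, hh⟩ := hoff p hpne
      refine ⟨h, ?_⟩
      rw [hsing p hpne, Submodule.span_singleton_le_iff_mem]
      exact hh
    · refine ⟨1, ?_⟩
      change Submodule.span F (limUnit b '' _) ≤ _
      rw [Submodule.span_le]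
      rintro _ ⟨p, hpg, rfl⟩
      exact absurd ⟨p, hpg⟩ hp

end DirectLimit

/-! ### The main theorem -/

theorem mainTheorem4 {F : Type u} [Field F] {V : Type v} [AddCommGroup V]
    [Module F V] (b : Module.Basis ℕ F V) :
    -- every group grading on the algebra of all upper triangular maps has a proper finite
    -- refinement, and no group grading on this algebra is fine
    (∀ (G : Type w) [Group G] (Γ : GroupGrading F G (upperTriangular b)),
      (∃ (H : Type w') (_ : Group H) (Γ' : GroupGrading F H (upperTriangular b)),
        Γ'.IsFinite ∧ Γ'.IsProperRefinementOf Γ) ∧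
      ¬ GroupGrading.IsFine.{w'} Γ) ∧
    -- the grading on the direct limit algebra defined by `γ(i) = δ_i` is fine, and every fine
    -- group grading on this algebra is equivalent to it
    GroupGrading.IsFine.{w'} (elementaryGrading b deltaMap) ∧
    (∀ (G : Type w) [Group G] (Γ : GroupGrading F G (upperTriangularLim b)),
      GroupGrading.IsFine.{w'} Γ → Γ.Equivalent (elementaryGrading b deltaMap)) := by
  refine ⟨fun G _ Γ => ?_, isFine_elementaryGrading_deltaMap b,
    fun G _ Γ hΓ => equivalent_elementaryGrading_of_isFine b Γ hΓ⟩
  obtain ⟨H, hH, Γ', hfin, hr⟩ : ∃ (H : Type w') (_ : Group H)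
      (Γ' : GroupGrading F H (upperTriangular b)), Γ'.IsFinite ∧ Γ'.IsProperRefinementOf Γ :=
    exists_finite_properRefinement b Γ
  exact ⟨⟨H, hH, Γ', hfin, hr⟩, fun hfine => hfine H Γ' hr⟩
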